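/- Fix path-loss exponents $\alpha,\beta>2$, a cut-off distance $\nu>1$, noise variance $\sigma^2>0$, an SINR target $\theta>0$, an outage level $0<\epsilon<1$, a duty cycle $0<\omega\le 1$, beam responses $z_m,z_s>0$ and an integer $K\ge 0$. Cellular network of density $\lambda_b>0$: the typical base station $Y_0$ is at the origin of $\mathbb R^2$, the other base stations form a homogeneous Poisson process $\Phi$ of density $\lambda_b$, and, given the base stations, the active mobiles $U_Y$, one per base station $Y$, are independent and uniformly distributed in the Voronoi cells of their base stations; write $U_0=U_{Y_0}$. Let $\mathcal C$ be the set of base stations serving the $K$ interfering mobiles (those other than $U_0$) nearest to the origin. If mobiles transmit with power $p$, the outage probability is $$P_{\mathsf{out}}(\lambda_b,p)=\Pr\left(\frac{p|U_0|^{-\alpha}}{\sum_{Y\in\Phi\setminus\mathcal C}p|U_Y|^{-\alpha}+\sigma^2}<\theta\right).$$ Let $\mu>0$ be such that, for density $\lambda_b=1$, $\Pr\bigl(\sum_{Y\in\Phi\setminus\mathcal C}|U_Y|^{-\alpha}-\theta^{-1}|U_0|^{-\alpha}+\mu>0\bigr)=\epsilon$. Power beacons (PBs) form a homogeneous Poisson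 process $\Psi$ of density $\lambda_p\ge 0$, independent of base stations and mobiles. With PB transmission power $q\ge 0$, the raw power received by the typical mobile $U_0$ is, for isotropic microwave power transfer (MPT), $$P=q\sum_{T\in\Psi}\max(|T-U_0|,\nu)^{-\beta},$$ and, for directed MPT, with $T_0$ the point of $\Psi$ nearest to $U_0$, $$P=z_mq\max(|T_0-U_0|,\nu)^{-\beta}+z_sq\sum_{T\in\Psi\setminus\{T_0\}}\max(|T-U_0|,\nu)^{-\beta}$$ (and $P=0$ if $\Psi=\emptyset$). Time is divided into slots of unit length, and everything is independent over slots. In each slot the typical mobile adds the received energy to an initially empty storage of infinite capacity; independently of the point processes and mobile positions it is active with probability $\omega$, and when active it transmits with power $p$ if the energy stored at the beginning of the slot is at least $p$. The feasibility region $\mathcal F_h$ is the set of $(q,\lambda_b,\lambda_p)$ with $q\ge 0$, $\lambda_b>0$, $\lambda_p\ge 0$ for which there is $p\ge 0$ such that the long-run probability that the stored energy is at least $p$, that is, the limit as $n\to\infty$ of the average over the first $n$ slots of the probabilities of this event, is $1$, and $P_{\mathsf{out}}(\lambda_b,p)\le\epsilon$. Then: 1. For isotropic MPT, $$\mathcal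 F_h=\left\{(q,\lambda_b,\lambda_p)\in\mathbb R_+^3 : q\lambda_p\lambda_b^{\alpha/2}\ge\left(1-\frac2\beta\right)\frac{\sigma^2\omega\nu^{\beta-2}}{\pi\mu}\right\},$$ where $\mathbb R_+$ is the set of nonnegative numbers. 2. For directed MPT, with $\kappa=\omega\sigma^2\nu^\beta/\mu$, $$\left\{(q,\lambda_b,\lambda_p)\in\mathbb R_+^3 : \lambda_p\ge\frac1{\pi\nu^2}\log\frac{z_mq\lambda_b^{\alpha/2}}{z_mq\lambda_b^{\alpha/2}-\kappa},\ (z_mq)^{2/\alpha}\lambda_b\ge\kappa^{2/\alpha}\right\}\subset\mathcal F_h,$$ where the logarithm is $+\infty$, so that no $\lambda_p$ qualifies, if $z_mq\lambda_b^{\alpha/2}=\kappa$. -/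

import Mathlib

open MeasureTheory ProbabilityTheory Filter Topology
open scoped ENNReal

namespace PowerBeacon

noncomputable section

/-- The Euclidean plane; `volume` is the area. -/
abbrev Plane : Type := EuclideanSpace ℝ (Fin 2)

/-- The counting measure `A ↦ #(S ∩ A)` of a configuration `S` of points. -/
def counting (S : Set Plane) : Measure Plane := Measure.count.restrict S

/-- `Φ` is a homogeneous Poisson point process of density `dens` on the plane: a random locally
finite set whose numbers of points in Borel sets `A` of finite area are Poisson variables of mean
`dens * area A`, independent for disjoint sets. -/
structure IsPoissonProcess {Ω : Type*} [MeasurableSpace Ω] (Pr : Measure Ω) (dens : ℝ)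
    (Φ : Ω → Set Plane) : Prop where
  locallyFinite : ∀ w r, (Φ w ∩ Metric.closedBall 0 r).Finite
  measurable : Measurable fun w => counting (Φ w)
  count_law : ∀ A : Set Plane, MeasurableSet A → volume A ≠ ∞ → ∀ k : ℕ,
    Pr {w | (Φ w ∩ A).encard = k} =
      ENNReal.ofReal (Real.exp (-(dens * volume.real A)) * (dens * volume.real A) ^ k /
        (k.factorial : ℝ))
  indep : ∀ (n : ℕ) (A : Fin n → Set Plane), (∀ i, MeasurableSet (A i)) →
    (∀ i, volume (A i) ≠ ∞) → Pairwise (fun i j => Disjoint (A i) (A j)) →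
    iIndepFun (fun i w => counting (Φ w) (A i)) Pr

/-- The Voronoi cell of the `n`-th point of the sequence `y`. -/
def voronoiCell (y : ℕ → Plane) (n : ℕ) : Set Plane :=
  {x | ∀ m, dist x (y n) ≤ dist x (y m)}

/-- The uplink cellular network of base-station density `dens`, seen from the typical base station
`Y 0` at the origin. The other base stations `Y 1, Y 2, …`, labelled by increasing distance from
the origin, form a Poisson process, and, given the base stations, the active mobiles `U n` are
independent and uniformly distributed in the Voronoi cells of the `Y n`. -/
structure IsCellularNetwork {Ω : Type*} [MeasurableSpace Ω] (Pr : Measure Ω) (dens : ℝ)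
    (Y U : ℕ → Ω → Plane) : Prop where
  measurable_station : ∀ n, Measurable (Y n)
  measurable_mobile : ∀ n, Measurable (U n)
  typical : ∀ w, Y 0 w = 0
  poisson : IsPoissonProcess Pr dens fun w => Set.range fun n => Y (n + 1) w
  ordered : ∀ᵐ w ∂Pr, StrictMono fun n => ‖Y n w‖
  uniform : ∀ A : Set (ℕ → Plane), MeasurableSet A → ∀ (s : Finset ℕ) (B : ℕ → Set Plane),
    (∀ i, MeasurableSet (B i)) →
    Pr {w | (fun n => Y n w) ∈ A ∧ ∀ i ∈ s, U i w ∈ B i} =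
      ∫⁻ w in {w | (fun n => Y n w) ∈ A},
        ∏ i ∈ s, (volume[|voronoiCell (fun n => Y n w) i]) (B i) ∂Pr

/-- The indices of the base stations, other than the typical one, whose mobile is not among the
`K` interfering mobiles nearest to the origin (whose interference is cancelled). -/
def interferers (K : ℕ) (u : ℕ → Plane) : Set ℕ :=
  {n | 1 ≤ n ∧ (K : ℕ∞) ≤ {m | 1 ≤ m ∧ ‖u m‖ < ‖u n‖}.encard}

/-- The interference power at the typical base station if all active mobiles, located at `u n`,
transmit with power `p`. -/
def interference (α : ℝ) (K : ℕ) (p : ℝ) (u : ℕ → Plane) : ℝ≥0∞ :=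
  ∑' n : interferers K u, ENNReal.ofReal p * ‖u n‖ₑ ^ (-α)

/-- The received signal-to-interference-and-noise ratio at the typical base station; the noise
variance is `σ ^ 2`. -/
def sinr (α σ : ℝ) (K : ℕ) (p : ℝ) (u : ℕ → Plane) : ℝ≥0∞ :=
  ENNReal.ofReal p * ‖u 0‖ₑ ^ (-α) / (interference α K p u + ENNReal.ofReal (σ ^ 2))

/-- The raw power received at the location `u` from power beacons at the points of `S` that
radiate isotropically with power `q`. -/
def isotropicPower (β ν q : ℝ) (S : Set Plane) (u : Plane) : ℝ≥0∞ :=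
  ∑' T : S, ENNReal.ofReal (q * max (dist (T : Plane) u) ν ^ (-β))

open scoped Classical in
/-- The raw power received at the location `u` under beamforming: the nearest power beacon acts
through its main lobe `zm`, all others through their side lobes `zs`. -/
def directedPower (β ν zm zs q : ℝ) (S : Set Plane) (u : Plane) : ℝ≥0∞ :=
  ∑' T : S, ENNReal.ofReal
    ((if ∀ T' ∈ S, dist (T : Plane) u ≤ dist T' u then zm else zs) *
      q * max (dist (T : Plane) u) ν ^ (-β))

/-- A hybrid network in slotted time, with base-station density `lb`, power-beacon density `lp`
and duty cycle `duty`. In slot `t` the base stations and active mobiles are `Y t` and `U t`, the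
power beacons are `Ψ t`, and `active t` says whether the typical mobile has a packet to transmit. -/
structure HybridNetwork (lb lp duty : ℝ) where
  Ω : Type*
  [mΩ : MeasurableSpace Ω]
  Pr : Measure Ω
  [prob : IsProbabilityMeasure Pr]
  Y : ℕ → ℕ → Ω → Plane
  U : ℕ → ℕ → Ω → Plane
  Ψ : ℕ → Ω → Set Plane
  active : ℕ → Ω → Bool
  cellular : ∀ t, IsCellularNetwork Pr lb (Y t) (U t)
  beacons : ∀ t, IsPoissonProcess Pr lp (Ψ t)
  measurable_active : ∀ t, Measurable (active t)
  active_prob : ∀ t, Pr {w | active t w = true} = ENNReal.ofReal duty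
  indep_beacons : ∀ t, IndepFun (fun w => ((fun n => Y t n w), (fun n => U t n w)))
    (fun w => counting (Ψ t w)) Pr
  indep_active : ∀ t, IndepFun (active t)
    (fun w => ((fun n => Y t n w), (fun n => U t n w), counting (Ψ t w))) Pr
  indep_slots : iIndepFun (fun t w =>
    (active t w, (fun n => Y t n w), (fun n => U t n w), counting (Ψ t w))) Pr

attribute [instance] HybridNetwork.mΩ HybridNetwork.prob

namespace HybridNetwork

variable {lb lp duty : ℝ}

/-- The energy in the infinite storage of the typical mobile at the beginning of slot `t` (slots
have unit length). In each slot the mobile harvests the raw power `power (Ψ t) (U t 0)`; in active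
slots it transmits with power `p` if the stored energy allows it. -/
def storedEnergy (N : HybridNetwork lb lp duty) (power : Set Plane → Plane → ℝ≥0∞) (p : ℝ) :
    ℕ → N.Ω → ℝ≥0∞
  | 0, _ => 0
  | t + 1, w =>
      (if N.active t w = true ∧ ENNReal.ofReal p ≤ N.storedEnergy power p t w
        then N.storedEnergy power p t w - ENNReal.ofReal p
        else N.storedEnergy power p t w) + power (N.Ψ t w) (N.U t 0 w)

/-- The (long-run) probability that the mobile has enough energy to transmit with power `p`
is one. -/
def CanTransmit (N : HybridNetwork lb lp duty) (power : Set Plane → Plane → ℝ≥0∞) (p : ℝ) :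
    Prop :=
  Tendsto (fun n : ℕ => (∑ t ∈ Finset.range n,
    N.Pr.real {w | ENNReal.ofReal p ≤ N.storedEnergy power p t w}) / (n : ℝ)) atTop (𝓝 1)

/-- The probability that, in slot `t`, the signal-to-interference-and-noise ratio at the typical
base station is below `θ` if the mobiles transmit with power `p`. -/
def outageProb (N : HybridNetwork lb lp duty) (α σ θ : ℝ) (K : ℕ) (p : ℝ) (t : ℕ) : ℝ≥0∞ :=
  N.Pr {w | sinr α σ K p (fun n => N.U t n w) < ENNReal.ofReal θ}

/-- Mobiles with infinite energy storage can transmit reliably with some power `p` for which the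
outage constraint is satisfied. -/
def Feasible (N : HybridNetwork lb lp duty) (power : Set Plane → Plane → ℝ≥0∞)
    (α σ θ : ℝ) (K : ℕ) (ε : ℝ) : Prop :=
  ∃ p : ℝ, 0 ≤ p ∧ N.CanTransmit power p ∧ ∀ t, N.outageProb α σ θ K p t ≤ ENNReal.ofReal ε

end HybridNetwork

/-- The feasibility region: all `(q, lb, lp)` such that the network of densities `lb` and `lp` is
feasible when the power beacons transmit with power `q`. Here `power q S u` is the raw power
received at `u` from power beacons at the points of `S`. -/
def feasibilityRegion {duty : ℝ}
    (N : ∀ lb lp : ℝ, 0 < lb → 0 ≤ lp → HybridNetwork lb lp duty)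
    (power : ℝ → Set Plane → Plane → ℝ≥0∞) (α σ θ : ℝ) (K : ℕ) (ε : ℝ) : Set (ℝ × ℝ × ℝ) :=
  {x | ∃ (_ : 0 ≤ x.1) (hb : 0 < x.2.1) (hp : 0 ≤ x.2.2),
    (N x.2.1 x.2.2 hb hp).Feasible (power x.1) α σ θ K ε}

end

end PowerBeacon

namespace PowerBeacon

/-! Feasibility asks for one power `p` that meets two constraints, and each is equivalent to, or
implied by, an explicit inequality in `p`.

Outage bounds `p` from below. Dilating the plane by `√lb` turns a network of density `lb` into one
of density 1 and the outage event into `weakSignal` with noise `σ ^ 2 / (p * lb ^ (α / 2))`. The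
probability of `weakSignal` is monotone in the noise, equals `ε` at `μ`, and exceeds `ε` at every
larger noise (`measure_weakSignal_lt`). Hence the constraint reads `σ ^ 2 / μ ≤ p * lb ^ (α / 2)`
(`outage_le_iff`).

Storage bounds `p` from above. Activity in a slot is independent of the stored energy, so the mean
number of transmissions is `duty` times the sum of the probabilities of having enough energy. By
conservation of energy, `duty * p` cannot exceed the mean harvest if these probabilities average to
one (`le_lintegral_of_tendsto_average`). Conversely, if the mean harvest is at least `duty * p`,
equality included, the strong law gives a transmission in almost every active slot
(`tendsto_average_of_le`).

The mean isotropic power comes from Campbell's formula. The directed power is at least `zm * q * ν ^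
(-β)` when some beacon lies within `ν`, an event given by a void probability. Eliminating `p` yields
both claims.

Since the processes are specified only through counts and conditional laws, it must also be shown
that the density determines the law of the Poisson process and of the network
(`IsPoissonProcess.map_eq`, `IsCellularNetwork.map_eq`), and that the received power is a measurable
function of the counting measure. -/

/-! ### Received power as a measurable function of the counting measure -/

lemma measurableSet_annulus (n : ℕ) : MeasurableSet {x : Plane | ⌊‖x‖⌋₊ = n} :=
  (Nat.measurable_floor.comp measurable_norm) (measurableSet_singleton n)

/-- The part of a measure in the annulus `n ≤ ‖x‖ < n + 1`, if its mass lies in `[k, k + 1)`. -/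
noncomputable def annulusKernel (n k : ℕ) : Kernel (Measure Plane) Plane where
  toFun M := ({M : Measure Plane | M {x | ⌊‖x‖⌋₊ = n} ∈ Set.Ico (k : ℝ≥0∞) (k + 1)}.indicator
    (fun M => M.restrict {x | ⌊‖x‖⌋₊ = n})) M
  measurable' := by
    have hn := measurableSet_annulus n
    refine Measurable.indicator ?_ ?_
    · refine Measure.measurable_of_measurable_coe _ fun s hs => ?_
      simp_rw [Measure.restrict_apply hs]
      exact Measure.measurable_coe (hs.inter hn)
    · exact Measure.measurable_coe hn measurableSet_Ico

/-- The cut-off at mass `k + 1` bounds the kernel uniformly over all measures; this is the purpose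
of splitting by `k`. -/
instance (n k : ℕ) : IsFiniteKernel (annulusKernel n k) := by
  refine ⟨⟨(k : ℝ≥0∞) + 1, by simp, fun M => ?_⟩⟩
  change ({M : Measure Plane | M {x | ⌊‖x‖⌋₊ = n} ∈ Set.Ico (k : ℝ≥0∞) (k + 1)}.indicator
    (fun M => M.restrict {x | ⌊‖x‖⌋₊ = n})) M Set.univ ≤ _
  by_cases h : M ∈ {M : Measure Plane | M {x | ⌊‖x‖⌋₊ = n} ∈ Set.Ico (k : ℝ≥0∞) (k + 1)}
  · rw [Set.indicator_of_mem h]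
    simpa using h.2.le
  · rw [Set.indicator_of_notMem h]
    simp

/-- An s-finite kernel that maps every locally finite measure on the plane to itself. -/
noncomputable def locallyFiniteKernel : Kernel (Measure Plane) Plane :=
  Kernel.sum fun n => Kernel.sum fun k => annulusKernel n k

instance : IsSFiniteKernel locallyFiniteKernel := by
  unfold locallyFiniteKernel; infer_instance

lemma sum_annulusKernel (n : ℕ) (M : Measure Plane) (h : M {x | ⌊‖x‖⌋₊ = n} ≠ ∞) :
    Kernel.sum (fun k => annulusKernel n k) M = M.restrict {x | ⌊‖x‖⌋₊ = n} := by
  ext s hs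
  rw [Kernel.sum_apply' _ _ hs]
  have hk : ∃ k : ℕ, M {x | ⌊‖x‖⌋₊ = n} ∈ Set.Ico (k : ℝ≥0∞) (k + 1) := by
    lift M {x | ⌊‖x‖⌋₊ = n} to NNReal using h with a
    refine ⟨⌊a⌋₊, ?_, ?_⟩
    · exact_mod_cast Nat.floor_le a.2
    · exact_mod_cast Nat.lt_floor_add_one a
  obtain ⟨k, hk⟩ := hk
  have e (j : ℕ) : annulusKernel n j M s =
      ({M : Measure Plane | M {x | ⌊‖x‖⌋₊ = n} ∈ Set.Ico (j : ℝ≥0∞) (j + 1)}.indicator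
    (fun M => M.restrict {x | ⌊‖x‖⌋₊ = n})) M s := rfl
  rw [tsum_eq_single k, e, Set.indicator_of_mem (by exact hk)]
  intro j hj
  rw [e, Set.indicator_of_notMem]
  · simp
  · intro hj'
    have h1 : (k : ℝ≥0∞) < j + 1 := hk.1.trans_lt hj'.2
    have h2 : (j : ℝ≥0∞) < k + 1 := hj'.1.trans_lt hk.2
    norm_cast at h1 h2
    omega

lemma locallyFiniteKernel_apply (M : Measure Plane) (h : ∀ n : ℕ, M {x | ⌊‖x‖⌋₊ = n} ≠ ∞) :
    locallyFiniteKernel M = M := by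
  rw [locallyFiniteKernel, Kernel.sum_apply]
  simp_rw [sum_annulusKernel _ M (h _)]
  rw [← Measure.restrict_iUnion]
  · have : (⋃ i : ℕ, {x : Plane | ⌊‖x‖⌋₊ = i}) = Set.univ := by
      ext x; simp
    rw [this, Measure.restrict_univ]
  · intro i j hij
    refine Set.disjoint_left.2 fun x hx hx' => hij ?_
    exact hx.symm.trans hx'
  · exact measurableSet_annulus

/-- Local finiteness of a configuration of points. -/
def LocFin (S : Set Plane) : Prop := ∀ r, (S ∩ Metric.closedBall 0 r).Finite

lemma LocFin.countable {S : Set Plane} (h : LocFin S) : S.Countable := by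
  have : S = ⋃ n : ℕ, S ∩ Metric.closedBall 0 n := by
    rw [← Set.inter_iUnion, Metric.iUnion_closedBall_nat, Set.inter_univ]
  rw [this]
  exact Set.countable_iUnion fun n => (h n).countable

lemma counting_apply {S : Set Plane} (h : S.Countable) {A : Set Plane} (hA : MeasurableSet A) :
    counting S A = (S ∩ A).encard := by
  rw [counting, Measure.restrict_apply hA, Measure.count_apply (hA.inter h.measurableSet),
    Set.inter_comm]

lemma lintegral_counting {S : Set Plane} (h : S.Countable) (f : Plane → ℝ≥0∞) :
    ∫⁻ x, f x ∂(counting S) = ∑' x : S, f x := by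
  rw [counting, ← lintegral_indicator h.measurableSet, lintegral_count, ← tsum_subtype]

/-- Integrals against a random configuration thereby become integrals against an s-finite kernel,
which are jointly measurable in the configuration and further parameters. -/
lemma LocFin.kernel_apply {S : Set Plane} (h : LocFin S) :
    locallyFiniteKernel (counting S) = counting S := by
  refine locallyFiniteKernel_apply _ fun n => ?_
  rw [counting_apply h.countable (measurableSet_annulus n)]
  have : (S ∩ {x | ⌊‖x‖⌋₊ = n}).Finite := by
    refine (h (n + 1)).subset fun x hx => ⟨hx.1, ?_⟩
    have h2 : ⌊‖x‖⌋₊ = n := hx.2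
    rw [mem_closedBall_zero_iff]
    have := (Nat.lt_floor_add_one ‖x‖).le
    rwa [h2] at this
  simpa using this

/-- The received power, as a function of a measure and a location. -/
noncomputable def isotropicOf (β ν q : ℝ) (z : Measure Plane × Plane) : ℝ≥0∞ :=
  ∫⁻ x, ENNReal.ofReal (q * max (dist x z.2) ν ^ (-β)) ∂(locallyFiniteKernel z.1)

open scoped Classical in
/-- The power received under beamforming, as a function of a measure and a location. -/
noncomputable def directedOf (β ν zm zs q : ℝ) (z : Measure Plane × Plane) : ℝ≥0∞ :=
  ∫⁻ x, ENNReal.ofReal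
    ((if locallyFiniteKernel z.1 (Metric.ball z.2 (dist x z.2)) = 0 then zm else zs) *
      q * max (dist x z.2) ν ^ (-β)) ∂(locallyFiniteKernel z.1)

/-- The kernel on the product that ignores the location. -/
noncomputable abbrev fstKernel (E : Type*) [MeasurableSpace E] :
    Kernel (Measure Plane × E) Plane :=
  locallyFiniteKernel.comap Prod.fst measurable_fst

lemma measurable_isotropicOf (β ν q : ℝ) : Measurable (isotropicOf β ν q) := by
  have := Measurable.lintegral_kernel_prod_right' (κ := fstKernel Plane)
    (f := fun z => ENNReal.ofReal (q * max (dist z.2 z.1.2) ν ^ (-β))) (by fun_prop)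
  exact this

lemma measurable_directedOf (β ν zm zs q : ℝ) : Measurable (directedOf β ν zm zs q) := by
  -- The candidate point enters as a parameter next to the location, so that the mass of the open
  -- ball reaching up to it is jointly measurable in all three arguments.
  have h1 : Measurable fun z : (Measure Plane × Plane) × Plane =>
      locallyFiniteKernel z.1.1 (Metric.ball z.1.2 (dist z.2 z.1.2)) := by
    have hs : MeasurableSet {y : (Measure Plane × (Plane × Plane)) × Plane |
        dist y.2 y.1.2.1 < dist y.1.2.2 y.1.2.1} :=
      measurableSet_lt (by fun_prop) (by fun_prop)
    have := Kernel.measurable_kernel_prodMk_left (κ := fstKernel (Plane × Plane)) hs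
    exact this.comp (g := fun z : (Measure Plane × (Plane × Plane)) =>
      fstKernel (Plane × Plane) z (Prod.mk z ⁻¹' {y | dist y.2 y.1.2.1 < dist y.1.2.2 y.1.2.1}))
      (f := fun z : (Measure Plane × Plane) × Plane => (z.1.1, z.1.2, z.2)) (by fun_prop)
  classical
  have h2 : Measurable fun z : (Measure Plane × Plane) × Plane =>
      if locallyFiniteKernel z.1.1 (Metric.ball z.1.2 (dist z.2 z.1.2)) = 0 then zm else zs :=
    Measurable.ite (h1 (measurableSet_singleton 0)) measurable_const measurable_const
  have := Measurable.lintegral_kernel_prod_right' (κ := fstKernel Plane)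
    (f := fun z : (Measure Plane × Plane) × Plane => ENNReal.ofReal
      ((if locallyFiniteKernel z.1.1 (Metric.ball z.1.2 (dist z.2 z.1.2)) = 0 then zm else zs) *
      q * max (dist z.2 z.1.2) ν ^ (-β))) (by fun_prop)
  unfold directedOf
  convert this
  rfl

lemma isotropicPower_eq (β ν q : ℝ) {S : Set Plane} (h : LocFin S) (u : Plane) :
    isotropicPower β ν q S u = isotropicOf β ν q (counting S, u) := by
  rw [isotropicOf, h.kernel_apply, lintegral_counting h.countable, isotropicPower]

/-- A beacon is nearest to `u` exactly when the open ball about `u` that reaches up to it contains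
no beacon. -/
lemma directedPower_eq (β ν zm zs q : ℝ) {S : Set Plane} (h : LocFin S) (u : Plane) :
    directedPower β ν zm zs q S u = directedOf β ν zm zs q (counting S, u) := by
  rw [directedOf, h.kernel_apply, lintegral_counting h.countable, directedPower]
  refine tsum_congr fun T => ?_
  have : counting S (Metric.ball u (dist (T : Plane) u)) = 0 ↔
      ∀ T' ∈ S, dist (T : Plane) u ≤ dist T' u := by
    rw [counting_apply h.countable measurableSet_ball]
    simp [Set.eq_empty_iff_forall_notMem]
  congr 3
  classical exact if_congr this.symm rfl rfl


/-! ### Poisson processes: counts, Campbell's formula, uniqueness in law -/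

open Bornology

lemma tsum_ofReal_poisson {m : ℝ} (hm : 0 ≤ m) :
    ∑' k : ℕ, ENNReal.ofReal (Real.exp (-m) * m ^ k / (k.factorial : ℝ)) = 1 := by
  have := hasSum_one_poissonMeasure ⟨m, hm⟩
  change HasSum (fun k => Real.exp (-m) * m ^ k / (k.factorial : ℝ)) 1 at this
  rw [← ENNReal.ofReal_tsum_of_nonneg (fun k => by positivity) this.summable, this.tsum_eq,
    ENNReal.ofReal_one]

lemma tsum_mul_ofReal_poisson {m : ℝ} (hm : 0 ≤ m) :
    ∑' k : ℕ, (k : ℝ≥0∞) * ENNReal.ofReal (Real.exp (-m) * m ^ k / (k.factorial : ℝ)) =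
      ENNReal.ofReal m := by
  rw [tsum_eq_zero_add' ENNReal.summable, Nat.cast_zero, zero_mul, zero_add]
  have e (k : ℕ) : ((k + 1 : ℕ) : ℝ≥0∞) *
      ENNReal.ofReal (Real.exp (-m) * m ^ (k + 1) / ((k + 1).factorial : ℝ)) =
      ENNReal.ofReal m * ENNReal.ofReal (Real.exp (-m) * m ^ k / (k.factorial : ℝ)) := by
    rw [← ENNReal.ofReal_natCast, ← ENNReal.ofReal_mul (by positivity),
      ← ENNReal.ofReal_mul hm]
    congr 1
    rw [Nat.factorial_succ]
    push_cast
    field_simp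
    ring
  simp_rw [e]
  rw [ENNReal.tsum_mul_left, tsum_ofReal_poisson hm, mul_one]

lemma _root_.Bornology.IsBounded.volume_ne_top {A : Set Plane} (h : IsBounded A) :
    volume A ≠ ∞ := h.measure_lt_top.ne

lemma LocFin.inter_finite {S : Set Plane} (h : LocFin S) {A : Set Plane} (hA : IsBounded A) :
    (S ∩ A).Finite := by
  obtain ⟨r, hr⟩ := hA.subset_closedBall 0
  exact (h r).subset (Set.inter_subset_inter_right _ hr)

lemma LocFin.exists_counting_eq {S : Set Plane} (h : LocFin S) {A : Set Plane}
    (hA : MeasurableSet A) (hb : IsBounded A) : ∃ k : ℕ, counting S A = k := by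
  refine ⟨(S ∩ A).ncard, ?_⟩
  rw [counting_apply h.countable hA, ← (h.inter_finite hb).cast_ncard_eq]
  rfl

lemma LocFin.counting_eq_iff {S : Set Plane} (h : LocFin S) {A : Set Plane}
    (hA : MeasurableSet A) (k : ℕ) : counting S A = k ↔ (S ∩ A).encard = k := by
  rw [counting_apply h.countable hA]
  norm_cast

section

variable {Ω : Type*} [MeasurableSpace Ω] {Pr : Measure Ω} {dens : ℝ} {Φ : Ω → Set Plane}

lemma IsPoissonProcess.locFin (h : IsPoissonProcess Pr dens Φ) (w : Ω) : LocFin (Φ w) :=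
  h.locallyFinite w

lemma IsPoissonProcess.measurable_apply (h : IsPoissonProcess Pr dens Φ) {A : Set Plane}
    (hA : MeasurableSet A) : Measurable fun w => counting (Φ w) A :=
  (Measure.measurable_coe hA).comp h.measurable

/-- The law of the number of points in a bounded set. -/
lemma IsPoissonProcess.map_apply (h : IsPoissonProcess Pr dens Φ) {A : Set Plane}
    (hA : MeasurableSet A) (hb : IsBounded A) :
    Pr.map (fun w => counting (Φ w) A) = Measure.sum fun k : ℕ =>
      ENNReal.ofReal (Real.exp (-(dens * volume.real A)) * (dens * volume.real A) ^ k /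
        (k.factorial : ℝ)) • Measure.dirac (k : ℝ≥0∞) := by
  ext B hB
  have hm := h.measurable_apply hA
  have e : (fun w => counting (Φ w) A) ⁻¹' B =
      ⋃ k : ℕ, {w | counting (Φ w) A = k} ∩ {_w : Ω | (k : ℝ≥0∞) ∈ B} := by
    ext w
    obtain ⟨k, hk⟩ := (h.locFin w).exists_counting_eq hA hb
    simp only [Set.mem_preimage, Set.mem_iUnion, Set.mem_inter_iff]
    constructor
    · intro hw
      exact ⟨k, hk, show (k : ℝ≥0∞) ∈ B from hk ▸ hw⟩
    · rintro ⟨j, hj, hj'⟩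
      have hj : counting (Φ w) A = j := hj
      rw [hj]; exact hj'
  rw [Measure.map_apply hm hB, e, measure_iUnion, Measure.sum_apply _ hB]
  · refine tsum_congr fun k => ?_
    rw [Measure.smul_apply, Measure.dirac_apply' _ hB, smul_eq_mul]
    by_cases hk : (k : ℝ≥0∞) ∈ B
    · rw [Set.indicator_of_mem hk, Pi.one_apply, mul_one,
        ← h.count_law A hA hb.volume_ne_top k]
      congr 1
      ext w
      exact ⟨fun hw => ((h.locFin w).counting_eq_iff hA k).1 hw.1,
        fun hw => ⟨((h.locFin w).counting_eq_iff hA k).2 hw, hk⟩⟩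
    · rw [Set.indicator_of_notMem hk, mul_zero]
      convert measure_empty (μ := Pr)
      ext w
      exact ⟨fun hw => hk hw.2, fun hw => hw.elim⟩
  · intro i j hij
    refine Set.disjoint_left.2 fun w hi hj => hij ?_
    have h1 : counting (Φ w) A = i := hi.1
    have h2 : counting (Φ w) A = j := hj.1
    exact_mod_cast h1.symm.trans h2
  · intro k
    exact (hm (measurableSet_singleton (k : ℝ≥0∞))).inter (MeasurableSet.const _)

lemma IsPoissonProcess.lintegral_apply (h : IsPoissonProcess Pr dens Φ) (hd : 0 ≤ dens)
    {A : Set Plane} (hA : MeasurableSet A) (hb : IsBounded A) :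
    ∫⁻ w, counting (Φ w) A ∂Pr = ENNReal.ofReal dens * volume A := by
  have : ∫⁻ w, counting (Φ w) A ∂Pr = ∫⁻ x, x ∂(Pr.map fun w => counting (Φ w) A) :=
    (lintegral_map measurable_id (h.measurable_apply hA)).symm
  rw [this, h.map_apply hA hb, lintegral_sum_measure]
  simp_rw [lintegral_smul_measure, lintegral_dirac, smul_eq_mul, mul_comm (ENNReal.ofReal _)]
  rw [tsum_mul_ofReal_poisson (by positivity), ENNReal.ofReal_mul hd, mul_comm]
  congr 1
  exact ofReal_measureReal hb.volume_ne_top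

/-- The mean measure of a Poisson process. -/
lemma IsPoissonProcess.join_map (h : IsPoissonProcess Pr dens Φ) (hd : 0 ≤ dens) :
    (Pr.map fun w => counting (Φ w)).join = ENNReal.ofReal dens • volume := by
  -- The mean count is known for bounded sets only, so the two measures are compared on balls
  -- exhausting the plane.
  rw [Measure.ext_iff_of_iUnion_eq_univ (Metric.iUnion_closedBall_nat (0 : Plane))]
  intro n
  ext A hA
  have hm : MeasurableSet (A ∩ Metric.closedBall 0 n) := hA.inter measurableSet_closedBall
  rw [Measure.restrict_apply hA, Measure.restrict_apply hA, Measure.join_apply hm,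
    lintegral_map (Measure.measurable_coe hm) h.measurable,
    h.lintegral_apply hd hm (Metric.isBounded_closedBall.subset Set.inter_subset_right),
    Measure.smul_apply, smul_eq_mul]

/-- **Campbell's formula** -/
lemma IsPoissonProcess.campbell (h : IsPoissonProcess Pr dens Φ) (hd : 0 ≤ dens)
    {f : Plane → ℝ≥0∞} (hf : Measurable f) :
    ∫⁻ w, ∫⁻ x, f x ∂(counting (Φ w)) ∂Pr = ENNReal.ofReal dens * ∫⁻ x, f x := by
  rw [← lintegral_map (f := fun M => ∫⁻ x, f x ∂M) (Measure.measurable_lintegral hf) h.measurable,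
    ← Measure.lintegral_join hf.aemeasurable, h.join_map hd, lintegral_smul_measure, smul_eq_mul]

/-- The atoms of the algebra generated by a finite family of sets. -/
def atom {ι : Type*} (A : ι → Set Plane) (b : Finset ι) : Set Plane := {x | ∀ i, x ∈ A i ↔ i ∈ b}

lemma measurableSet_atom {ι : Type*} [Countable ι] {A : ι → Set Plane}
    (hA : ∀ i, MeasurableSet (A i)) (b : Finset ι) : MeasurableSet (atom A b) := by
  have : atom A b = ⋂ i, {x | x ∈ A i ↔ i ∈ b} := by
    ext x
    rw [Set.mem_iInter]
    rfl
  rw [this]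
  refine MeasurableSet.iInter fun i => ?_
  by_cases hi : i ∈ b
  · simpa [hi] using hA i
  · have : {x | x ∈ A i ↔ i ∈ b} = (A i)ᶜ := by
      ext x
      simp [hi]
    rw [this]
    exact (hA i).compl

lemma pairwise_disjoint_atom {ι : Type*} (A : ι → Set Plane) :
    Pairwise fun b b' => Disjoint (atom A b) (atom A b') := by
  intro b b' hb
  refine Set.disjoint_left.2 fun x hx hx' => hb ?_
  ext i
  exact (hx i).symm.trans (hx' i)

open scoped Classical in
-- The atom of the empty index set, the complement of the union, is left out: it is unbounded if the
-- sets are bounded.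
lemma measure_eq_sum_atom {ι : Type*} [Fintype ι] {A : ι → Set Plane}
    (hA : ∀ i, MeasurableSet (A i)) (M : Measure Plane) (i : ι) :
    M (A i) = ∑ b : {b : Finset ι // b.Nonempty}, if i ∈ b.1 then M (atom A b) else 0 := by
  have e : A i = ⋃ b ∈ (Finset.univ.filter fun b : {b : Finset ι // b.Nonempty} => i ∈ b.1),
      atom A b.1 := by
    ext x
    simp only [Finset.mem_filter, Finset.mem_univ, true_and, Set.mem_iUnion, exists_prop]
    constructor
    · intro hx
      refine ⟨⟨Finset.univ.filter fun j => x ∈ A j, ⟨i, by simpa using hx⟩⟩, by simpa using hx,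
        fun j => by simp⟩
    · rintro ⟨b, hb, hx⟩
      exact (hx i).2 hb
  conv_lhs => rw [e]
  rw [measure_biUnion_finset, Finset.sum_filter]
  · intro b _ b' _ hb
    exact pairwise_disjoint_atom A fun h => hb (Subtype.ext h)
  · exact fun b _ => measurableSet_atom hA b

end

section

variable {Ω Ω' : Type*} [MeasurableSpace Ω] [MeasurableSpace Ω'] {Pr : Measure Ω}
  {Pr' : Measure Ω'} [IsProbabilityMeasure Pr] [IsProbabilityMeasure Pr'] {dens : ℝ}
  {Φ : Ω → Set Plane} {Φ' : Ω' → Set Plane}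

lemma IsPoissonProcess.map_fin_eq (h : IsPoissonProcess Pr dens Φ)
    (h' : IsPoissonProcess Pr' dens Φ') {n : ℕ} {A : Fin n → Set Plane}
    (hA : ∀ i, MeasurableSet (A i)) (hb : ∀ i, IsBounded (A i))
    (hd : Pairwise fun i j => Disjoint (A i) (A j)) :
    Pr.map (fun w i => counting (Φ w) (A i)) = Pr'.map (fun w i => counting (Φ' w) (A i)) := by
  rw [(iIndepFun_iff_map_fun_eq_pi_map
      fun i => (h.measurable_apply (hA i)).aemeasurable).1
      (h.indep n A hA (fun i => (hb i).volume_ne_top) hd),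
    (iIndepFun_iff_map_fun_eq_pi_map
      fun i => (h'.measurable_apply (hA i)).aemeasurable).1
      (h'.indep n A hA (fun i => (hb i).volume_ne_top) hd)]
  congr 1
  ext1 i
  rw [h.map_apply (hA i) (hb i), h'.map_apply (hA i) (hb i)]

/-- Overlapping sets reduce to disjoint ones: their counts are a fixed linear function `g` of the
counts of the bounded atoms. -/
lemma IsPoissonProcess.map_family_eq (h : IsPoissonProcess Pr dens Φ)
    (h' : IsPoissonProcess Pr' dens Φ') {ι : Type*} [Finite ι] {A : ι → Set Plane}
    (hA : ∀ i, MeasurableSet (A i)) (hb : ∀ i, IsBounded (A i)) :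
    Pr.map (fun w i => counting (Φ w) (A i)) = Pr'.map (fun w i => counting (Φ' w) (A i)) := by
  classical
  have := Fintype.ofFinite ι
  let e := Fintype.equivFin {b : Finset ι // b.Nonempty}
  let g : (Fin (Fintype.card {b : Finset ι // b.Nonempty}) → ℝ≥0∞) → ι → ℝ≥0∞ :=
    fun v i => ∑ b : {b : Finset ι // b.Nonempty}, if i ∈ b.1 then v (e b) else 0
  have hg : Measurable g := by
    refine measurable_pi_lambda _ fun i => Finset.measurable_sum _ fun b _ => ?_
    split_ifs
    · exact measurable_pi_apply _
    · exact measurable_const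
  let B : Fin (Fintype.card {b : Finset ι // b.Nonempty}) → Set Plane :=
    fun j => atom A (e.symm j).1
  have hB : ∀ j, MeasurableSet (B j) := fun j => measurableSet_atom hA _
  have hBb : ∀ j, IsBounded (B j) := fun j => by
    obtain ⟨i, hi⟩ := (e.symm j).2
    exact (hb i).subset fun x hx => (hx i).2 hi
  have hBd : Pairwise fun i j => Disjoint (B i) (B j) := fun i j hij =>
    pairwise_disjoint_atom A fun h => hij (e.symm.injective (Subtype.ext h))
  have key (M : Measure Plane) : (fun i => M (A i)) = g fun j => M (B j) := by
    ext i
    refine (measure_eq_sum_atom hA M i).trans (Finset.sum_congr rfl fun b _ => ?_)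
    dsimp only
    rw [show B (e b) = atom A b.1 by simp only [B, Equiv.symm_apply_apply]]
  rw [show (fun w i => counting (Φ w) (A i)) = g ∘ fun w j => counting (Φ w) (B j) from
      funext fun w => key _,
    show (fun w i => counting (Φ' w) (A i)) = g ∘ fun w j => counting (Φ' w) (B j) from
      funext fun w => key _]
  have hm : Measurable fun w j => counting (Φ w) (B j) :=
    measurable_pi_lambda _ fun j => h.measurable_apply (hB j)
  have hm' : Measurable fun w j => counting (Φ' w) (B j) :=
    measurable_pi_lambda _ fun j => h'.measurable_apply (hB j)
  have := congrArg (Measure.map g) (h.map_fin_eq h' hB hBb hBd)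
  rwa [Measure.map_map hg hm, Measure.map_map hg hm'] at this

/-- Bounded Borel sets. -/
abbrev BoundedBorel : Type := {A : Set Plane // MeasurableSet A ∧ IsBounded A}

/-- The mass of any Borel set is the supremum of the masses of its intersections with balls, so
bounded sets generate the σ-algebra. -/
lemma iSup_comap_boundedBorel :
    (Measure.instMeasurableSpace : MeasurableSpace (Measure Plane)) =
      ⨆ A ∈ (Set.univ : Set BoundedBorel),
        MeasurableSpace.comap (fun M : Measure Plane => M A.1) inferInstance := by
  apply le_antisymm
  · refine iSup₂_le fun A hA => ?_
    rw [← measurable_iff_comap_le]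
    have e : (fun M : Measure Plane => M A) =
        fun M => ⨆ n : ℕ, M (A ∩ Metric.closedBall 0 n) := by
      ext M
      rw [← Monotone.measure_iUnion, ← Set.inter_iUnion, Metric.iUnion_closedBall_nat,
        Set.inter_univ]
      intro m n hmn
      exact Set.inter_subset_inter_right _ (Metric.closedBall_subset_closedBall (by exact_mod_cast hmn))
    rw [e]
    refine Measurable.iSup fun n => ?_
    rw [measurable_iff_comap_le]
    exact le_iSup₂_of_le (⟨A ∩ Metric.closedBall 0 n, hA.inter measurableSet_closedBall,
      Metric.isBounded_closedBall.subset Set.inter_subset_right⟩ : BoundedBorel) (Set.mem_univ _)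
      le_rfl
  · refine iSup₂_le fun A _ => ?_
    rw [← measurable_iff_comap_le]
    exact Measure.measurable_coe A.2.1

/-- The law of a Poisson process is determined by its density. -/
theorem IsPoissonProcess.map_eq (h : IsPoissonProcess Pr dens Φ)
    (h' : IsPoissonProcess Pr' dens Φ') :
    Pr.map (fun w => counting (Φ w)) = Pr'.map (fun w => counting (Φ' w)) := by
  have := Measure.isProbabilityMeasure_map (μ := Pr) h.measurable.aemeasurable
  have := Measure.isProbabilityMeasure_map (μ := Pr') h'.measurable.aemeasurable
  -- Events fixing the counts of finitely many bounded sets form a generating π-system.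
  refine ext_of_generate_finite _ (iSup_comap_boundedBorel.trans
    (generateFrom_piiUnionInter_measurableSet _ _).symm)
    (isPiSystem_piiUnionInter _
      (fun A => @MeasurableSpace.isPiSystem_measurableSet _ (MeasurableSpace.comap _ _)) _) ?_
    (by simp)
  rintro _ ⟨t, -, f, hf, rfl⟩
  choose! B hB using hf
  have hB1 : ∀ A ∈ t, MeasurableSet (B A) := fun A hA => (hB A hA).1
  have hB2 : ∀ A ∈ t, f A = (fun M : Measure Plane => M A.1) ⁻¹' B A := fun A hA =>
    (hB A hA).2.symm
  have e : ⋂ A ∈ t, f A = (fun (M : Measure Plane) (A : t) => M A.1.1) ⁻¹'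
      (Set.univ.pi fun A : t => B A.1) := by
    ext M
    simp only [Set.mem_iInter, Set.mem_preimage, Set.mem_univ_pi, Subtype.forall]
    constructor
    · intro H A hA hA'
      have := H A hA hA'
      rwa [hB2 _ hA'] at this
    · intro H A hA hA'
      rw [hB2 _ hA']
      exact H A hA hA'
  have hm : Measurable fun (M : Measure Plane) (A : t) => M A.1.1 :=
    measurable_pi_lambda _ fun A => Measure.measurable_coe A.1.2.1
  have hp : MeasurableSet (Set.univ.pi fun A : t => B A.1) :=
    MeasurableSet.univ_pi fun A => hB1 A.1 A.2
  rw [e, ← Measure.map_apply hm hp, ← Measure.map_apply hm hp, Measure.map_map hm h.measurable,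
    Measure.map_map hm h'.measurable]
  exact congrArg (fun M : Measure (t → ℝ≥0∞) => M _) (h.map_family_eq h'
    (A := fun A : t => A.1.1) (fun A => A.1.2.1) fun A => A.1.2.2)

end


/-! ### Recovering the ordered base stations from the counting measure -/

section Rank

/-- If exactly `n` members of a strictly increasing sequence are at most `p`, they are the first
`n`. -/
lemma le_iff_lt_of_encard {r : ℕ → ℝ} (hr : StrictMono r) {p : ℝ} {n : ℕ}
    (h : {j | r j ≤ p}.encard = n) (j : ℕ) : r j ≤ p ↔ j < n := by
  constructor
  · intro hj
    have : (Finset.range (j + 1) : Set ℕ) ⊆ {j | r j ≤ p} := by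
      intro i hi
      exact (hr.monotone (by simpa [Nat.lt_succ_iff] using hi)).trans hj
    have := Set.encard_le_encard this
    rw [h, Set.encard_coe_eq_coe_finsetCard, Finset.card_range] at this
    exact_mod_cast this
  · intro hj
    by_contra hj'
    have : {j | r j ≤ p} ⊆ (Finset.range j : Set ℕ) := by
      intro i hi
      have : r i < r j := lt_of_le_of_lt hi (not_le.1 hj')
      simpa using hr.lt_iff_lt.1 this
    have := Set.encard_le_encard this
    rw [h, Set.encard_coe_eq_coe_finsetCard, Finset.card_range] at this
    have : n ≤ j := by exact_mod_cast this
    omega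

variable {y : ℕ → Plane}

lemma injective_of_strictMono_norm (hy : StrictMono fun n => ‖y n‖) : Function.Injective y :=
  fun _ _ h => hy.injective (congrArg norm h)

lemma encard_range_inter_closedBall (hy : StrictMono fun n => ‖y n‖) (p : ℝ) :
    (Set.range (fun n => y (n + 1)) ∩ Metric.closedBall 0 p).encard =
      {j | ‖y (j + 1)‖ ≤ p}.encard := by
  have : Set.range (fun n => y (n + 1)) ∩ Metric.closedBall 0 p =
      (fun n => y (n + 1)) '' {j | ‖y (j + 1)‖ ≤ p} := by
    ext x
    simp only [Set.mem_inter_iff, Set.mem_range, mem_closedBall_zero_iff, Set.mem_image]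
    constructor
    · rintro ⟨⟨j, rfl⟩, hj⟩
      exact ⟨j, hj, rfl⟩
    · rintro ⟨j, hj, rfl⟩
      exact ⟨⟨j, rfl⟩, hj⟩
  rw [this, Function.Injective.encard_image]
  exact (injective_of_strictMono_norm hy).comp (add_left_injective 1)

/-- The event, for the counting measure of a configuration, that the `n`-th point in the order of
the distances from the origin lies in `A`. -/
def stationEvent (A : Set Plane) : ℕ → Set (Measure Plane)
  | 0 => {_M | (0 : Plane) ∈ A}
  | n + 1 => ⋃ p : ℚ, ⋃ q : ℚ, {M | M (Metric.closedBall 0 p) = n} ∩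
      {M | M (Metric.closedBall 0 q) = (n + 1 : ℕ)} ∩
      {M | M (A ∩ (Metric.closedBall 0 q \ Metric.closedBall 0 p)) ≠ 0}

lemma measurableSet_stationEvent {A : Set Plane} (hA : MeasurableSet A) (n : ℕ) :
    MeasurableSet (stationEvent A n) := by
  cases n with
  | zero => exact MeasurableSet.const _
  | succ n =>
    refine MeasurableSet.iUnion fun p => MeasurableSet.iUnion fun q => ?_
    refine MeasurableSet.inter (MeasurableSet.inter ?_ ?_) ?_
    · exact Measure.measurable_coe measurableSet_closedBall (measurableSet_singleton _)
    · exact Measure.measurable_coe measurableSet_closedBall (measurableSet_singleton _)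
    · exact Measure.measurable_coe (hA.inter (measurableSet_closedBall.diff
        measurableSet_closedBall)) (measurableSet_singleton 0).compl

/-- If the balls of radii `p` and `q` hold `n` and `n + 1` of the points `y 1, y 2, …`, the only one
in between is `y (n + 1)`. Rational radii make the union countable. -/
lemma mem_stationEvent_iff (h0 : y 0 = 0) (hy : StrictMono fun n => ‖y n‖)
    (hf : LocFin (Set.range fun n => y (n + 1))) {A : Set Plane} (hA : MeasurableSet A) (n : ℕ) :
    counting (Set.range fun n => y (n + 1)) ∈ stationEvent A n ↔ y n ∈ A := by
  have hr : StrictMono fun n => ‖y (n + 1)‖ := fun i j hij => hy (Nat.succ_lt_succ hij)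
  have hball (p : ℝ) (k : ℕ) : counting (Set.range fun n => y (n + 1)) (Metric.closedBall 0 p) = k ↔
      {j | ‖y (j + 1)‖ ≤ p}.encard = k := by
    rw [hf.counting_eq_iff measurableSet_closedBall, encard_range_inter_closedBall hy]
  have hset (p : ℝ) (k : ℕ) (h1 : ‖y k‖ < p) (h2 : p < ‖y (k + 1)‖) :
      {j | ‖y (j + 1)‖ ≤ p}.encard = k := by
    have : {j | ‖y (j + 1)‖ ≤ p} = (Finset.range k : Set ℕ) := by
      ext j
      simp only [Finset.coe_range, Set.mem_Iio]
      constructor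
      · intro hj
        have hj : ‖y (j + 1)‖ ≤ p := hj
        exact Nat.succ_lt_succ_iff.1 (hy.lt_iff_lt.1 (hj.trans_lt h2))
      · intro hj
        exact (hy.monotone (Nat.succ_le_of_lt hj)).trans h1.le
    rw [this, Set.encard_coe_eq_coe_finsetCard, Finset.card_range]
  cases n with
  | zero => rw [h0]; rfl
  | succ n =>
    simp only [stationEvent, Set.mem_iUnion]
    constructor
    · rintro ⟨p, q, ⟨hp, hq⟩, hpq⟩
      have hp' := le_iff_lt_of_encard hr ((hball p n).1 hp)
      have hq' := le_iff_lt_of_encard hr ((hball q (n + 1)).1 hq)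
      have hpq : counting (Set.range fun n => y (n + 1))
        (A ∩ (Metric.closedBall 0 q \ Metric.closedBall 0 p)) ≠ 0 := hpq
      rw [counting_apply hf.countable (hA.inter (measurableSet_closedBall.diff
        measurableSet_closedBall))] at hpq
      have : (Set.range (fun n => y (n + 1)) ∩
          (A ∩ (Metric.closedBall 0 (q : ℝ) \ Metric.closedBall 0 (p : ℝ)))).Nonempty := by
        rw [← Set.encard_ne_zero]
        exact fun h => hpq (by rw [h]; simp)
      obtain ⟨_, ⟨j, rfl⟩, hjA, hjq, hjp⟩ := this
      rw [mem_closedBall_zero_iff, hq'] at hjq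
      rw [mem_closedBall_zero_iff, hp'] at hjp
      have : j = n := by omega
      rwa [this] at hjA
    · intro hn
      -- Strict ordering leaves room for a rational radius on either side of `‖y (n + 1)‖`.
      obtain ⟨p, hp1, hp2⟩ := exists_rat_btwn (hy (Nat.lt_succ_self n))
      obtain ⟨q, hq1, hq2⟩ := exists_rat_btwn (hy (Nat.lt_succ_self (n + 1)))
      refine ⟨p, q, ⟨(hball p n).2 (hset p n hp1 hp2), (hball q _).2 (hset q _ hq1 hq2)⟩, ?_⟩
      change counting _ _ ≠ 0
      rw [counting_apply hf.countable (hA.inter (measurableSet_closedBall.diff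
        measurableSet_closedBall))]
      have : (Set.range (fun n => y (n + 1)) ∩
          (A ∩ (Metric.closedBall 0 (q : ℝ) \ Metric.closedBall 0 (p : ℝ)))).Nonempty := by
        refine ⟨y (n + 1), ⟨n, rfl⟩, hn, ?_, ?_⟩
        · rw [mem_closedBall_zero_iff]; exact hq1.le
        · rw [mem_closedBall_zero_iff]; exact not_le.2 hp2
      simpa [Set.encard_eq_zero] using this.ne_empty

end Rank

/-! ### Voronoi cells and uniqueness in law of the cellular network -/

section Cells

lemma measurableSet_voronoiCell (y : ℕ → Plane) (i : ℕ) : MeasurableSet (voronoiCell y i) := by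
  have : voronoiCell y i = ⋂ m, {x | dist x (y i) ≤ dist x (y m)} := by
    ext x
    rw [Set.mem_iInter]
    rfl
  rw [this]
  exact MeasurableSet.iInter fun m => measurableSet_le (by fun_prop) (by fun_prop)

lemma measurable_cond_voronoiCell (i : ℕ) {B : Set Plane} (hB : MeasurableSet B) :
    Measurable fun y : ℕ → Plane => (volume[|voronoiCell y i]) B := by
  have hs : MeasurableSet {z : (ℕ → Plane) × Plane | z.2 ∈ voronoiCell z.1 i} := by
    have : {z : (ℕ → Plane) × Plane | z.2 ∈ voronoiCell z.1 i} =
        ⋂ m, {z | dist z.2 (z.1 i) ≤ dist z.2 (z.1 m)} := by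
      ext x
      rw [Set.mem_iInter]
      rfl
    rw [this]
    exact MeasurableSet.iInter fun m => measurableSet_le (by fun_prop) (by fun_prop)
  have h1 : Measurable fun y : ℕ → Plane => volume (voronoiCell y i) :=
    measurable_measure_prodMk_left hs
  have h2 : Measurable fun y : ℕ → Plane => volume (voronoiCell y i ∩ B) :=
    measurable_measure_prodMk_left (hs.inter (measurable_snd hB))
  simp_rw [cond_apply (measurableSet_voronoiCell _ _)]
  exact h1.inv.mul h2

lemma measurable_prod_cond_voronoiCell (s : Finset ℕ) {B : ℕ → Set Plane}
    (hB : ∀ i, MeasurableSet (B i)) :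
    Measurable fun y : ℕ → Plane => ∏ i ∈ s, (volume[|voronoiCell y i]) (B i) :=
  Finset.measurable_prod _ fun i _ => measurable_cond_voronoiCell i (hB i)

end Cells

lemma measurableSet_cylinder (s : Finset ℕ) {B : ℕ → Set Plane} (hB : ∀ i, MeasurableSet (B i)) :
    MeasurableSet {x : ℕ → Plane | ∀ i ∈ s, x i ∈ B i} := by
  have : {x : ℕ → Plane | ∀ i ∈ s, x i ∈ B i} = ⋂ i ∈ s, (fun x => x i) ⁻¹' B i := by
    ext w
    rw [Set.mem_iInter₂]
    rfl
  rw [this]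
  exact s.measurableSet_biInter fun i _ => measurable_pi_apply i (hB i)

/-- Finite measures on a countable product are determined by the cylinders. -/
lemma measure_ext_of_cylinders {μ ν : Measure (ℕ → Plane)} [IsFiniteMeasure μ]
    (h : ∀ (s : Finset ℕ) (B : ℕ → Set Plane), (∀ i, MeasurableSet (B i)) →
      μ {x | ∀ i ∈ s, x i ∈ B i} = ν {x | ∀ i ∈ s, x i ∈ B i}) : μ = ν := by
  refine ext_of_generate_finite _ generateFrom_squareCylinders.symm
    (isPiSystem_squareCylinders (fun _ => MeasurableSpace.isPiSystem_measurableSet)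
      (by simp)) ?_ ?_
  · rintro _ ⟨s, t, ht, rfl⟩
    exact h s t fun i => ht i (Set.mem_univ i)
  · simpa using h ∅ (fun _ => Set.univ) fun _ => MeasurableSet.univ

namespace IsCellularNetwork

variable {Ω : Type*} [MeasurableSpace Ω] {Pr : Measure Ω} {dens : ℝ} {Y U : ℕ → Ω → Plane}

lemma measurable_stations (h : IsCellularNetwork Pr dens Y U) :
    Measurable fun w n => Y n w := measurable_pi_lambda _ h.measurable_station

lemma measurable_mobiles (h : IsCellularNetwork Pr dens Y U) :
    Measurable fun w n => U n w := measurable_pi_lambda _ h.measurable_mobile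

/-- Given the base stations, the mobiles are independent and uniformly distributed. -/
lemma lintegral_mobiles (h : IsCellularNetwork Pr dens Y U) (s : Finset ℕ) {B : ℕ → Set Plane}
    (hB : ∀ i, MeasurableSet (B i)) {F : (ℕ → Plane) → ℝ≥0∞} (hF : Measurable F) :
    ∫⁻ w in {w | ∀ i ∈ s, U i w ∈ B i}, F (fun n => Y n w) ∂Pr =
      ∫⁻ w, (∏ i ∈ s, (volume[|voronoiCell (fun n => Y n w) i]) (B i)) * F (fun n => Y n w) ∂Pr := by
  have hY := h.measurable_stations
  have hg := (measurable_prod_cond_voronoiCell s hB).comp hY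
  -- The hypothesis `uniform`, read for all `A` at once, is an equality of measures on station
  -- sequences; the formula for `F` follows by integrating against both.
  have : (Pr.restrict {w | ∀ i ∈ s, U i w ∈ B i}).map (fun w n => Y n w) =
      (Pr.withDensity fun w => ∏ i ∈ s, (volume[|voronoiCell (fun n => Y n w) i]) (B i)).map
        (fun w n => Y n w) := by
    ext A hA
    rw [Measure.map_apply hY hA, Measure.map_apply hY hA, Measure.restrict_apply (hY hA),
      withDensity_apply _ (hY hA)]
    exact h.uniform A hA s B hB
  rw [← lintegral_map (f := F) hF hY, this, lintegral_map hF hY]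
  exact lintegral_withDensity_eq_lintegral_mul _ hg (hF.comp hY)

/-- Almost surely the stations are strictly ordered by norm, hence functions of the counting
measure, whose law the density determines. -/
lemma map_stations_cylinder (h : IsCellularNetwork Pr dens Y U) (s : Finset ℕ)
    {B : ℕ → Set Plane} (hB : ∀ i, MeasurableSet (B i)) :
    Pr.map (fun w n => Y n w) {x | ∀ i ∈ s, x i ∈ B i} =
      Pr.map (fun w => counting (Set.range fun n => Y (n + 1) w))
        (⋂ i ∈ s, stationEvent (B i) i) := by
  have hE : MeasurableSet (⋂ i ∈ s, stationEvent (B i) i) :=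
    s.measurableSet_biInter fun i _ => measurableSet_stationEvent (hB i) i
  rw [Measure.map_apply h.measurable_stations (measurableSet_cylinder s hB),
    Measure.map_apply h.poisson.measurable hE]
  refine measure_congr ?_
  filter_upwards [h.ordered] with w hw
  refine propext ?_
  change (∀ i ∈ s, Y i w ∈ B i) ↔
    counting (Set.range fun n => Y (n + 1) w) ∈ ⋂ i ∈ s, stationEvent (B i) i
  rw [Set.mem_iInter₂]
  exact forall₂_congr fun i _ => (mem_stationEvent_iff (y := fun n => Y n w) (h.typical w) hw
    (h.poisson.locFin w) (hB i) i).symm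

lemma map_mobiles_cylinder (h : IsCellularNetwork Pr dens Y U) {A : Set (ℕ → Plane)}
    (hA : MeasurableSet A) (s : Finset ℕ) {B : ℕ → Set Plane} (hB : ∀ i, MeasurableSet (B i)) :
    (Pr.restrict {w | (fun n => Y n w) ∈ A}).map (fun w n => U n w) {x | ∀ i ∈ s, x i ∈ B i} =
      ∫⁻ y in A, ∏ i ∈ s, (volume[|voronoiCell y i]) (B i) ∂(Pr.map (fun w n => Y n w)) := by
  have hD := measurableSet_cylinder s hB
  rw [Measure.map_apply h.measurable_mobiles hD,
    Measure.restrict_apply (h.measurable_mobiles hD),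
    setLIntegral_map hA (measurable_prod_cond_voronoiCell s hB) h.measurable_stations]
  refine Eq.trans ?_ (h.uniform A hA s B hB)
  congr 1
  ext w
  exact and_comm

variable {Ω' : Type*} [MeasurableSpace Ω'] {Pr' : Measure Ω'} {Y' U' : ℕ → Ω' → Plane}

lemma map_stations_eq [IsProbabilityMeasure Pr] [IsProbabilityMeasure Pr']
    (h : IsCellularNetwork Pr dens Y U) (h' : IsCellularNetwork Pr' dens Y' U') :
    Pr.map (fun w n => Y n w) = Pr'.map (fun w n => Y' n w) := by
  refine measure_ext_of_cylinders fun s B hB => ?_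
  rw [h.map_stations_cylinder s hB, h'.map_stations_cylinder s hB, h.poisson.map_eq h'.poisson]

/-- The law of a cellular network is determined by its density. -/
theorem map_eq [IsProbabilityMeasure Pr] [IsProbabilityMeasure Pr']
    (h : IsCellularNetwork Pr dens Y U) (h' : IsCellularNetwork Pr' dens Y' U') :
    Pr.map (fun w => ((fun n => Y n w), fun n => U n w)) =
      Pr'.map (fun w => ((fun n => Y' n w), fun n => U' n w)) := by
  have hY := h.measurable_stations
  have hY' := h'.measurable_stations
  have hU := h.measurable_mobiles
  have hU' := h'.measurable_mobiles
  refine Measure.ext_prod fun {A C} hA hC => ?_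
  -- With the event `A` for the stations fixed, the law of the mobiles is determined by its
  -- cylinders, which `uniform` expresses through the law of the stations.
  have key : (Pr.restrict {w | (fun n => Y n w) ∈ A}).map (fun w n => U n w) =
      (Pr'.restrict {w | (fun n => Y' n w) ∈ A}).map (fun w n => U' n w) := by
    refine measure_ext_of_cylinders fun s B hB => ?_
    rw [h.map_mobiles_cylinder hA s hB, h'.map_mobiles_cylinder hA s hB, h.map_stations_eq h']
  have := congrArg (fun M : Measure (ℕ → Plane) => M C) key
  simp only [Measure.map_apply hU hC, Measure.map_apply hU' hC, Measure.restrict_apply (hU hC),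
    Measure.restrict_apply (hU' hC)] at this
  rw [Measure.map_apply (hY.prodMk hU) (hA.prod hC), Measure.map_apply (hY'.prodMk hU')
    (hA.prod hC)]
  convert this using 2
  · ext w; exact and_comm
  · ext w; exact and_comm

/-- Given the base stations and the interfering mobiles, the typical mobile is uniformly distributed
in its cell. -/
lemma measure_typical_mobile [IsFiniteMeasure Pr] (h : IsCellularNetwork Pr dens Y U)
    {A C : Set (ℕ → Plane)} (hA : MeasurableSet A) (hC : MeasurableSet C) {B₀ : Set Plane}
    (hB₀ : MeasurableSet B₀) :
    Pr {w | (fun n => Y n w) ∈ A ∧ U 0 w ∈ B₀ ∧ (fun n => U (n + 1) w) ∈ C} =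
      ∫⁻ w in {w | (fun n => Y n w) ∈ A ∧ (fun n => U (n + 1) w) ∈ C},
        (volume[|voronoiCell (fun n => Y n w) 0]) B₀ ∂Pr := by
  have hY := h.measurable_stations
  have hV : Measurable fun w n => U (n + 1) w :=
    measurable_pi_lambda _ fun n => h.measurable_mobile _
  have hYA : MeasurableSet {w | (fun n => Y n w) ∈ A} := hY hA
  have key : (Pr.restrict ({w | (fun n => Y n w) ∈ A} ∩ {w | U 0 w ∈ B₀})).map
        (fun w n => U (n + 1) w) =
      ((Pr.restrict {w | (fun n => Y n w) ∈ A}).withDensity fun w =>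
        (volume[|voronoiCell (fun n => Y n w) 0]) B₀).map (fun w n => U (n + 1) w) := by
    refine measure_ext_of_cylinders fun s B hB => ?_
    have hD := measurableSet_cylinder s hB
    -- Indices are shifted by one to free index 0 for `B₀`.
    let s' : Finset ℕ := s.map (addRightEmbedding 1)
    let B' : ℕ → Set Plane := fun n => n.casesOn B₀ B
    have hB' : ∀ i, MeasurableSet (B' i) := by
      rintro (_ | i)
      · exact hB₀
      · exact hB i
    have hs' : 0 ∉ s' := by simp [s']
    have e1 : (fun w n => U (n + 1) w) ⁻¹' {x | ∀ i ∈ s, x i ∈ B i} =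
        {w | ∀ i ∈ s', U i w ∈ B' i} := by
      ext w
      simp [s', B']
    rw [Measure.map_apply hV hD, Measure.map_apply hV hD, Measure.restrict_apply (hV hD),
      withDensity_apply _ (hV hD), Measure.restrict_restrict (hV hD), e1]
    have e2 : {w | ∀ i ∈ s', U i w ∈ B' i} ∩ ({w | (fun n => Y n w) ∈ A} ∩ {w | U 0 w ∈ B₀}) =
        {w | (fun n => Y n w) ∈ A ∧ ∀ i ∈ insert 0 s', U i w ∈ B' i} := by
      ext w
      simp only [Finset.forall_mem_insert]
      exact ⟨fun ⟨a, b, c⟩ => ⟨b, c, a⟩, fun ⟨b, c, a⟩ => ⟨a, b, c⟩⟩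
    -- `uniform` for `insert 0 s'` gives a product whose factor at 0 is a function of the stations;
    -- `lintegral_mobiles` for `s'` turns the other factors back into an event.
    rw [e2, h.uniform A hA _ B' hB', Set.inter_comm, ← Measure.restrict_restrict hYA,
      ← lintegral_indicator hYA, ← lintegral_indicator hYA]
    have := h.lintegral_mobiles s' hB' (F := A.indicator fun y => (volume[|voronoiCell y 0]) B₀)
      ((measurable_cond_voronoiCell 0 hB₀).indicator hA)
    refine Eq.trans ?_ (Eq.trans this.symm ?_)
    · refine lintegral_congr fun w => ?_
      by_cases hw : (fun n => Y n w) ∈ A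
      · rw [Set.indicator_of_mem (by exact hw), Set.indicator_of_mem hw,
          Finset.prod_insert hs', mul_comm]
        rfl
      · rw [Set.indicator_of_notMem (by exact hw), Set.indicator_of_notMem hw, mul_zero]
    · rfl
  have := congrArg (fun M : Measure (ℕ → Plane) => M C) key
  simp only [Measure.map_apply hV hC, Measure.restrict_apply (hV hC),
    withDensity_apply _ (hV hC), Measure.restrict_restrict (hV hC)] at this
  convert this using 2
  · ext w; exact ⟨fun ⟨a, b, c⟩ => ⟨c, a, b⟩, fun ⟨c, a, b⟩ => ⟨a, b, c⟩⟩
  · congr 1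
    ext w; exact and_comm

end IsCellularNetwork


/-! ### Dilations of the plane -/

section Scaling

lemma volume_preimage_smul {c : ℝ} (hc : 0 < c) (s : Set Plane) :
    volume ((fun x : Plane => c • x) ⁻¹' s) = ENNReal.ofReal (c ^ 2)⁻¹ * volume s := by
  rw [Measure.addHaar_preimage_smul _ hc.ne', finrank_euclideanSpace_fin, abs_of_nonneg (by positivity)]

lemma measurable_smul_plane (c : ℝ) : Measurable fun x : Plane => c • x :=
  measurable_const_smul c

lemma counting_image_smul {c : ℝ} (hc : 0 < c) {S : Set Plane} (hS : S.Countable) {A : Set Plane}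
    (hA : MeasurableSet A) :
    counting ((fun x => c • x) '' S) A = counting S ((fun x => c • x) ⁻¹' A) := by
  rw [counting_apply (hS.image _) hA, counting_apply hS (measurable_smul_plane c hA),
    ← Set.image_inter_preimage, (smul_right_injective Plane hc.ne').encard_image]

lemma IsPoissonProcess.image_smul {Ω : Type*} [MeasurableSpace Ω] {Pr : Measure Ω} {dens : ℝ}
    {Φ : Ω → Set Plane} (h : IsPoissonProcess Pr dens Φ) {c : ℝ} (hc : 0 < c) :
    IsPoissonProcess Pr (dens / c ^ 2) fun w => (fun x => c • x) '' Φ w where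
  locallyFinite w r := by
    rw [← Set.image_inter_preimage]
    refine ((h.locFin w).inter_finite ?_).image _
    refine (Metric.isBounded_closedBall (x := (0 : Plane)) (r := r / c)).subset fun x hx => ?_
    rw [Set.mem_preimage, mem_closedBall_zero_iff, norm_smul, Real.norm_of_nonneg hc.le] at hx
    rw [mem_closedBall_zero_iff, le_div_iff₀ hc]
    linarith
  measurable := by
    refine Measure.measurable_of_measurable_coe _ fun A hA => ?_
    simp_rw [counting_image_smul hc (h.locFin _).countable hA]
    exact h.measurable_apply (measurable_smul_plane c hA)
  count_law A hA hA' k := by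
    have hv : volume.real ((fun x : Plane => c • x) ⁻¹' A) = (c ^ 2)⁻¹ * volume.real A := by
      rw [Measure.real, volume_preimage_smul hc, ENNReal.toReal_mul,
        ENNReal.toReal_ofReal (by positivity)]
      rfl
    have := h.count_law _ (measurable_smul_plane c hA)
      (by rw [volume_preimage_smul hc]; exact ENNReal.mul_ne_top ENNReal.ofReal_ne_top hA') k
    rw [hv, ← mul_assoc, ← div_eq_mul_inv] at this
    rw [← this]
    congr 1
    ext w
    change ((fun x => c • x) '' Φ w ∩ A).encard = k ↔
      (Φ w ∩ (fun x => c • x) ⁻¹' A).encard = k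
    rw [← Set.image_inter_preimage, (smul_right_injective Plane hc.ne').encard_image]
  indep n A hA hA' hd := by
    simp_rw [counting_image_smul hc (h.locFin _).countable (hA _)]
    exact h.indep n _ (fun i => measurable_smul_plane c (hA i))
      (fun i => by
        rw [volume_preimage_smul hc]; exact ENNReal.mul_ne_top ENNReal.ofReal_ne_top (hA' i))
      fun i j hij => (hd hij).preimage _

lemma dist_smul_smul {c : ℝ} (hc : 0 < c) (x y : Plane) : dist (c • x) (c • y) = c * dist x y := by
  rw [dist_smul₀, Real.norm_of_nonneg hc.le]

lemma preimage_voronoiCell_smul {c : ℝ} (hc : 0 < c) (y : ℕ → Plane) (i : ℕ) :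
    (fun x => c • x) ⁻¹' voronoiCell (fun n => c • y n) i = voronoiCell y i := by
  ext x
  change (∀ m, _) ↔ ∀ m, _
  simp_rw [dist_smul_smul hc]
  exact forall_congr' fun m => mul_le_mul_iff_right₀ hc

/-- The area factors of the cell and of its part in `B` cancel. -/
lemma cond_voronoiCell_smul {c : ℝ} (hc : 0 < c) (y : ℕ → Plane) (i : ℕ) (B : Set Plane) :
    (volume[|voronoiCell (fun n => c • y n) i]) B =
      (volume[|voronoiCell y i]) ((fun x => c • x) ⁻¹' B) := by
  rw [cond_apply (measurableSet_voronoiCell _ _), cond_apply (measurableSet_voronoiCell _ _),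
    ← preimage_voronoiCell_smul hc y i, ← Set.preimage_inter, volume_preimage_smul hc,
    volume_preimage_smul hc, ENNReal.mul_inv (Or.inl (by simp; positivity)) (Or.inl (by simp)),
    mul_mul_mul_comm, ENNReal.inv_mul_cancel (by simp; positivity) (by simp), one_mul]

lemma IsCellularNetwork.smul {Ω : Type*} [MeasurableSpace Ω] {Pr : Measure Ω} {dens : ℝ}
    {Y U : ℕ → Ω → Plane} (h : IsCellularNetwork Pr dens Y U) {c : ℝ} (hc : 0 < c) :
    IsCellularNetwork Pr (dens / c ^ 2) (fun n w => c • Y n w) (fun n w => c • U n w) where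
  measurable_station n := (h.measurable_station n).const_smul c
  measurable_mobile n := (h.measurable_mobile n).const_smul c
  typical w := by rw [h.typical, smul_zero]
  poisson := by
    convert h.poisson.image_smul hc using 2 with w
    rw [← Set.range_comp]
    rfl
  ordered := by
    filter_upwards [h.ordered] with w hw i j hij
    simp only [norm_smul, Real.norm_of_nonneg hc.le]
    exact mul_lt_mul_of_pos_left (hw hij) hc
  uniform A hA s B hB := by
    have hA' : MeasurableSet ((fun (y : ℕ → Plane) n => c • y n) ⁻¹' A) :=
      measurable_pi_lambda _ (fun n => (measurable_pi_apply n).const_smul c) hA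
    simp_rw [cond_voronoiCell_smul hc]
    exact h.uniform _ hA' s _ fun i => measurable_smul_plane c (hB i)

end Scaling

/-! ### Interference, noise and the weak-signal event -/

section Interference

lemma interference_congr {α : ℝ} {K : ℕ} {p : ℝ} {u v : ℕ → Plane} (h : ∀ n, 1 ≤ n → u n = v n) :
    interference α K p u = interference α K p v := by
  have e : interferers K u = interferers K v := by
    ext n
    refine and_congr_right fun hn => ?_
    have : {m | 1 ≤ m ∧ ‖u m‖ < ‖u n‖} = {m | 1 ≤ m ∧ ‖v m‖ < ‖v n‖} := by
      ext m
      refine and_congr_right fun hm => ?_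
      rw [h n hn, h m hm]
    rw [this]
  unfold interference
  rw [← e]
  exact tsum_congr fun n => by rw [h n n.2.1]

lemma enorm_smul_rpow {c : ℝ} (hc : 0 < c) (x : Plane) (α : ℝ) :
    ‖c • x‖ₑ ^ (-α) = ENNReal.ofReal (c ^ (-α)) * ‖x‖ₑ ^ (-α) := by
  rw [enorm_smul, ENNReal.mul_rpow_of_ne_top (by simp) (by simp), Real.enorm_of_nonneg hc.le,
    ENNReal.ofReal_rpow_of_pos hc]

lemma interference_smul {c : ℝ} (hc : 0 < c) (α : ℝ) (K : ℕ) (p : ℝ) (u : ℕ → Plane) :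
    interference α K p (fun n => c • u n) = ENNReal.ofReal (c ^ (-α)) * interference α K p u := by
  have e : interferers K (fun n => c • u n) = interferers K u := by
    ext n
    refine and_congr_right fun hn => ?_
    have : {m | 1 ≤ m ∧ ‖c • u m‖ < ‖c • u n‖} = {m | 1 ≤ m ∧ ‖u m‖ < ‖u n‖} := by
      ext m
      refine and_congr_right fun hm => ?_
      rw [norm_smul, norm_smul, Real.norm_of_nonneg hc.le]
      exact mul_lt_mul_iff_right₀ hc
    rw [this]
  unfold interference
  rw [e, ← ENNReal.tsum_mul_left]
  exact tsum_congr fun n => by rw [enorm_smul_rpow hc, mul_left_comm]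

lemma interference_eq_mul (α : ℝ) (K : ℕ) (p : ℝ) (u : ℕ → Plane) :
    interference α K p u = ENNReal.ofReal p * interference α K 1 u := by
  unfold interference
  rw [← ENNReal.tsum_mul_left]
  simp

/-- Having at least `K` elements becomes a countable union over finite sets, which gives
measurability of `interferers`. -/
lemma natCast_le_encard_iff (K : ℕ) (s : Set ℕ) :
    (K : ℕ∞) ≤ s.encard ↔ ∃ t : Finset ℕ, t.card = K ∧ ∀ m ∈ t, m ∈ s := by
  constructor
  · intro h
    obtain ⟨t, hts, ht⟩ := Set.exists_subset_encard_eq h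
    have hf : t.Finite := Set.finite_of_encard_eq_coe ht
    refine ⟨hf.toFinset, ?_, fun m hm => hts (by simpa using hm)⟩
    rw [hf.encard_eq_coe_toFinset_card] at ht
    exact_mod_cast ht
  · rintro ⟨t, rfl, hts⟩
    rw [← Set.encard_coe_eq_coe_finsetCard]
    exact Set.encard_le_encard hts

lemma measurableSet_interferers (K n : ℕ) :
    MeasurableSet {u : ℕ → Plane | n ∈ interferers K u} := by
  have : {u : ℕ → Plane | n ∈ interferers K u} = ⋃ t : Finset ℕ,
      {u | 1 ≤ n ∧ t.card = K} ∩ ⋂ m ∈ t, {u | 1 ≤ m} ∩ {u | ‖u m‖ < ‖u n‖} := by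
    ext u
    change (1 ≤ n ∧ _) ↔ _
    rw [natCast_le_encard_iff, Set.mem_iUnion]
    simp only [Set.mem_inter_iff, Set.mem_iInter]
    constructor
    · rintro ⟨hn, t, ht, h⟩
      exact ⟨t, ⟨hn, ht⟩, h⟩
    · rintro ⟨t, ⟨hn, ht⟩, h⟩
      exact ⟨hn, t, ht, h⟩
  rw [this]
  refine MeasurableSet.iUnion fun t => (MeasurableSet.const _).inter
    (t.measurableSet_biInter fun m _ => (MeasurableSet.const _).inter
      (measurableSet_lt (by fun_prop) (by fun_prop)))

lemma measurable_interference (α : ℝ) (K : ℕ) (p : ℝ) : Measurable (interference α K p) := by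
  unfold interference
  have e (u : ℕ → Plane) : (∑' n : interferers K u, ENNReal.ofReal p * ‖u n‖ₑ ^ (-α)) =
      ∑' n : ℕ, {u : ℕ → Plane | n ∈ interferers K u}.indicator
        (fun u => ENNReal.ofReal p * ‖u n‖ₑ ^ (-α)) u := by
    rw [tsum_subtype (interferers K u) fun n => ENNReal.ofReal p * ‖u n‖ₑ ^ (-α)]
    rfl
  simp_rw [e]
  refine Measurable.tsum fun n => Measurable.indicator ?_ (measurableSet_interferers K n)
  exact (((measurable_pi_apply n).enorm).pow_const _).const_mul _

lemma interference_one_le (α : ℝ) (K : ℕ) (u : ℕ → Plane) :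
    interference α K 1 u ≤ ∑' n : ℕ, ‖u (n + 1)‖ₑ ^ (-α) := by
  unfold interference
  rw [ENNReal.ofReal_one]
  simp_rw [one_mul]
  have : ∀ n : interferers K u, (n : ℕ) - 1 + 1 = n := fun n => Nat.sub_add_cancel n.2.1
  have hinj : Function.Injective fun n : interferers K u => (n : ℕ) - 1 := by
    intro a b hab
    apply Subtype.ext
    rw [← this a, ← this b]
    exact congrArg (· + 1) hab
  refine le_trans (le_of_eq ?_) (ENNReal.tsum_comp_le_tsum_of_injective hinj
    fun n => ‖u (n + 1)‖ₑ ^ (-α))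
  exact tsum_congr fun n => by rw [this n]

/-- The positions of the mobiles for which the signal is too weak, relative to the interference
and to noise of power `x`. -/
def weakSignal (α θ : ℝ) (K : ℕ) (x : ℝ) : Set (ℕ → Plane) :=
  {u | ENNReal.ofReal θ⁻¹ * ‖u 0‖ₑ ^ (-α) < interference α K 1 u + ENNReal.ofReal x}

lemma measurableSet_weakSignal (α θ : ℝ) (K : ℕ) (x : ℝ) : MeasurableSet (weakSignal α θ K x) :=
  measurableSet_lt ((((measurable_pi_apply 0).enorm).pow_const _).const_mul _)
    ((measurable_interference α K 1).add_const _)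

lemma weakSignal_mono (α θ : ℝ) (K : ℕ) : Monotone (weakSignal α θ K) := by
  intro x y hxy u hu
  have hu : ENNReal.ofReal θ⁻¹ * ‖u 0‖ₑ ^ (-α) < interference α K 1 u + ENNReal.ofReal x := hu
  exact lt_of_lt_of_le hu (add_le_add_right (ENNReal.ofReal_le_ofReal hxy) _)

/-- After division by `p`, outage means `θ⁻¹ ‖u 0‖ ^ (-α) < I + σ ^ 2 / p`. Dilation by `√b`
multiplies signal and interference by `b ^ (-α / 2)`, and the noise must follow. The condition `u 0
≠ 0` keeps the signal finite. -/
lemma sinr_lt_iff {α σ θ p b : ℝ} (hσ : 0 < σ) (hθ : 0 < θ) (hp : 0 < p)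
    (hb : 0 < b) (K : ℕ) {u : ℕ → Plane} (hu : u 0 ≠ 0) :
    sinr α σ K p u < ENNReal.ofReal θ ↔
      (fun n => √b • u n) ∈ weakSignal α θ K (σ ^ 2 / (p * b ^ (α / 2))) := by
  have hc : 0 < √b := Real.sqrt_pos.2 hb
  change _ ↔ ENNReal.ofReal θ⁻¹ * ‖√b • u 0‖ₑ ^ (-α) <
    interference α K 1 (fun n => √b • u n) + ENNReal.ofReal (σ ^ 2 / (p * b ^ (α / 2)))
  rw [interference_smul hc, enorm_smul_rpow hc, sinr, interference_eq_mul]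
  have hL : √b ^ (-α) = (b ^ (α / 2))⁻¹ := by
    rw [Real.sqrt_eq_rpow, ← Real.rpow_mul hb.le, ← Real.rpow_neg hb.le]
    congr 1
    ring
  rw [hL]
  have hL0 : 0 < b ^ (α / 2) := Real.rpow_pos_of_pos hb _
  generalize b ^ (α / 2) = L at hL0
  have ha : ‖u 0‖ₑ ^ (-α) ≠ ∞ := by
    rw [enorm_eq_nnnorm, ← ENNReal.coe_rpow_of_ne_zero (by simpa using hu)]
    exact ENNReal.coe_ne_top
  generalize ‖u 0‖ₑ ^ (-α) = a at ha
  -- With infinite interference both sides hold: the ratio is 0, and the finite signal is below `∞`.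
  by_cases hI : interference α K 1 u = ∞
  · rw [hI, ENNReal.mul_top (by simpa using hp), ENNReal.mul_top (by simpa using hL0), top_add,
      top_add, ENNReal.div_top]
    simp [hθ, ENNReal.mul_lt_top_iff, ha.lt_top]
  · generalize interference α K 1 u = I at hI
    rw [← ENNReal.ofReal_toReal ha, ← ENNReal.ofReal_toReal hI, ← ENNReal.ofReal_mul hp.le,
      ← ENNReal.ofReal_mul hp.le, ← ENNReal.ofReal_mul (by positivity),
      ← ENNReal.ofReal_mul (by positivity), ← ENNReal.ofReal_mul (by positivity),
      ← ENNReal.ofReal_add (by positivity) (by positivity),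
      ← ENNReal.ofReal_add (by positivity) (by positivity),
      ← ENNReal.ofReal_div_of_pos (by positivity), ENNReal.ofReal_lt_ofReal_iff hθ,
      ENNReal.ofReal_lt_ofReal_iff (by positivity)]
    rw [div_lt_iff₀ (by positivity), inv_mul_lt_iff₀ hθ, inv_mul_lt_iff₀ hL0]
    have : L * (θ * (L⁻¹ * I.toReal + σ ^ 2 / (p * L))) = θ * (p * I.toReal + σ ^ 2) / p := by
      field_simp
    rw [this, lt_div_iff₀ hp, mul_comm p]

end Interference


/-! ### Strict monotonicity of the outage probability -/

lemma lintegral_rpow_norm_lt_top {α r : ℝ} (hα : 2 < α) (hr : 0 < r) :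
    ∫⁻ x : Plane, {x : Plane | r < ‖x‖}.indicator (fun x => ‖x‖ₑ ^ (-α)) x < ∞ := by
  have h1 : ∫⁻ x : Plane, ENNReal.ofReal ((1 + ‖x‖) ^ (-α)) < ∞ :=
    finite_integral_one_add_norm (by simpa using hα)
  -- For `‖x‖ > r` one has `1 + ‖x‖ ≤ (1 / r + 1) * ‖x‖`.
  have h2 : ∀ x : Plane, {x : Plane | r < ‖x‖}.indicator (fun x => ‖x‖ₑ ^ (-α)) x ≤
      ENNReal.ofReal ((1 / r + 1) ^ α) * ENNReal.ofReal ((1 + ‖x‖) ^ (-α)) := by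
    intro x
    by_cases hx : r < ‖x‖
    · have hx0 : 0 < ‖x‖ := hr.trans hx
      rw [Set.indicator_of_mem (by exact hx), ← ofReal_norm,
        ENNReal.ofReal_rpow_of_pos hx0, ← ENNReal.ofReal_mul (by positivity)]
      refine ENNReal.ofReal_le_ofReal ?_
      rw [Real.rpow_neg (by positivity), Real.rpow_neg (by positivity), ← div_eq_mul_inv,
        ← Real.div_rpow (by positivity) (by positivity), ← Real.inv_rpow (by positivity)]
      refine Real.rpow_le_rpow (by positivity) ?_ (by linarith)
      rw [le_div_iff₀ (by positivity), inv_mul_le_iff₀ hx0]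
      have : 1 < ‖x‖ / r := (one_lt_div hr).2 hx
      have e : ‖x‖ * (1 / r + 1) = ‖x‖ / r + ‖x‖ := by ring
      rw [e]
      linarith
    · rw [Set.indicator_of_notMem (by exact hx)]
      exact zero_le
  refine (lintegral_mono h2).trans_lt ?_
  rw [lintegral_const_mul' _ _ ENNReal.ofReal_ne_top]
  exact ENNReal.mul_lt_top ENNReal.ofReal_lt_top h1

namespace IsCellularNetwork

variable {Ω : Type*} [MeasurableSpace Ω] {Pr : Measure Ω} {dens : ℝ}
  {Y U : ℕ → Ω → Plane}

/-- A mobile is at least half as far from the origin as its base station, because the origin is a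
base station too. -/
lemma ae_norm_station_le [IsProbabilityMeasure Pr] (h : IsCellularNetwork Pr dens Y U) :
    ∀ᵐ w ∂Pr, ∀ n, ‖Y n w‖ ≤ 2 * ‖U n w‖ := by
  rw [ae_all_iff]
  intro n
  have key (q : ℚ) : Pr {w | 2 * (q : ℝ) < ‖Y n w‖ ∧ ‖U n w‖ < q} = 0 := by
    have hA : MeasurableSet {y : ℕ → Plane | 2 * (q : ℝ) < ‖y n‖} :=
      measurableSet_lt measurable_const (measurable_pi_apply n).norm
    have := h.uniform _ hA {n} (fun _ => Metric.ball 0 q) fun _ => measurableSet_ball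
    simp only [Finset.mem_singleton, forall_eq, Finset.prod_singleton,
      mem_ball_zero_iff] at this
    change Pr {w | (fun n => Y n w) ∈ {y : ℕ → Plane | 2 * (q : ℝ) < ‖y n‖} ∧ ‖U n w‖ < q} = 0
    rw [this]
    refine setLIntegral_eq_zero (h.measurable_stations hA) fun w hw => ?_
    have hw : 2 * (q : ℝ) < ‖Y n w‖ := hw
    rw [cond_apply (measurableSet_voronoiCell _ _)]
    -- A point `x` of the cell is no farther from `Y n` than from the origin, so `‖Y n‖ ≤ 2 * ‖x‖`.
    have : voronoiCell (fun n => Y n w) n ∩ Metric.ball 0 (q : ℝ) = ∅ := by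
      refine Set.eq_empty_of_forall_notMem fun x hx => ?_
      have h1 : dist x (Y n w) ≤ dist x (Y 0 w) := hx.1 0
      have h2 := mem_ball_zero_iff.1 hx.2
      rw [h.typical, dist_zero_right] at h1
      have h3 := norm_sub_norm_le (Y n w) x
      rw [← dist_eq_norm, dist_comm] at h3
      linarith
    rw [this, measure_empty, mul_zero]
    rfl
  have : ∀ᵐ w ∂Pr, ∀ q : ℚ, ¬ (2 * (q : ℝ) < ‖Y n w‖ ∧ ‖U n w‖ < q) := by
    rw [ae_all_iff]
    intro q
    rw [ae_iff]
    simpa using key q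
  filter_upwards [this] with w hw
  by_contra! hlt
  obtain ⟨q, hq1, hq2⟩ := exists_rat_btwn (show ‖U n w‖ < ‖Y n w‖ / 2 by linarith)
  exact hw q ⟨by linarith, hq1⟩

lemma ae_mobile_ne_zero (h : IsCellularNetwork Pr dens Y U) : ∀ᵐ w ∂Pr, U 0 w ≠ 0 := by
  have := h.uniform Set.univ MeasurableSet.univ {0} (fun _ => {0}) fun _ => measurableSet_singleton 0
  simp only [Finset.mem_singleton, forall_eq, Finset.prod_singleton, Set.mem_univ, true_and,
    cond_apply (measurableSet_voronoiCell _ _)] at this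
  rw [ae_iff]
  simp only [not_not]
  refine this.trans ?_
  refine (lintegral_congr fun w => ?_).trans lintegral_zero
  rw [measure_mono_null Set.inter_subset_right (by simp), mul_zero]

/-- Conditioning on a cell of infinite area gives the zero measure, while `uniform` for the whole
plane forces mean total mass one. -/
lemma ae_volume_voronoiCell_ne_top [IsProbabilityMeasure Pr] (h : IsCellularNetwork Pr dens Y U) :
    ∀ᵐ w ∂Pr, volume (voronoiCell (fun n => Y n w) 0) ≠ ∞ := by
  have := h.uniform Set.univ MeasurableSet.univ {0} (fun _ => Set.univ) fun _ => MeasurableSet.univ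
  simp only [Finset.mem_singleton, forall_eq, Finset.prod_singleton, Set.mem_univ, true_and] at this
  have h1 : ∫⁻ w, (volume[|voronoiCell (fun n => Y n w) 0]) Set.univ ∂Pr = 1 := by
    have e : {_w : Ω | True} = Set.univ := rfl
    rw [e, measure_univ, Measure.restrict_univ] at this
    exact this.symm
  have hg : Measurable fun w => (volume[|voronoiCell (fun n => Y n w) 0]) Set.univ :=
    (measurable_cond_voronoiCell 0 MeasurableSet.univ).comp h.measurable_stations
  have hle : ∀ w, (volume[|voronoiCell (fun n => Y n w) 0]) Set.univ ≤ 1 := fun w => by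
    rw [cond_apply (measurableSet_voronoiCell _ _), Set.inter_univ]
    exact ENNReal.inv_mul_le_one _
  have := ae_eq_of_ae_le_of_lintegral_le (μ := Pr) (g := fun _ => 1) (ae_of_all _ hle)
    (by rw [h1]; exact ENNReal.one_ne_top) aemeasurable_const (by simp [h1])
  filter_upwards [this] with w hw htop
  rw [cond_apply (measurableSet_voronoiCell _ _), htop] at hw
  simp at hw

/-- The nearest other base station can be arbitrarily far away. -/
lemma measure_far_pos (h : IsCellularNetwork Pr dens Y U) (r : ℝ) :
    0 < Pr {w | r < ‖Y 1 w‖} := by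
  have := h.poisson.count_law (Metric.closedBall 0 r) measurableSet_closedBall
    Metric.isBounded_closedBall.measure_lt_top.ne 0
  rw [pow_zero, Nat.factorial_zero] at this
  have hpos : 0 < Pr {w | (Set.range (fun n => Y (n + 1) w) ∩ Metric.closedBall 0 r).encard =
      ((0 : ℕ) : ℕ∞)} := by
    rw [this, ENNReal.ofReal_pos]
    positivity
  refine hpos.trans_le (measure_mono fun w hw => ?_)
  have hw : (Set.range (fun n => Y (n + 1) w) ∩ Metric.closedBall 0 r).encard =
      ((0 : ℕ) : ℕ∞) := hw
  rw [Nat.cast_zero, Set.encard_eq_zero] at hw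
  change r < ‖Y 1 w‖
  by_contra! hle
  exact Set.eq_empty_iff_forall_notMem.1 hw (Y 1 w) ⟨⟨0, rfl⟩, by simpa using hle⟩

/-- Each mobile is at least half as far away as its station, so the interference is at most `2 ^ α`
times the sum of `‖Y n‖ ^ (-α)` over `n ≥ 1`. When all these stations lie beyond `r`, this sum
equals its truncation, which has finite mean by Campbell's formula; the singularity at the origin
would make the untruncated mean infinite. -/
lemma ae_interference_ne_top [IsProbabilityMeasure Pr] (h : IsCellularNetwork Pr dens Y U) (hd : 0 ≤ dens) {α r : ℝ}
    (hα : 2 < α) (hr : 0 < r) (K : ℕ) :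
    ∀ᵐ w ∂Pr, r < ‖Y 1 w‖ → interference α K 1 (fun n => U n w) ≠ ∞ := by
  have hf : Measurable fun x : Plane => {x : Plane | r < ‖x‖}.indicator (fun x => ‖x‖ₑ ^ (-α)) x :=
    (measurable_enorm.pow_const _).indicator (measurableSet_lt measurable_const measurable_norm)
  have hC := h.poisson.campbell hd hf
  have hfin : ∫⁻ w, ∫⁻ x, {x : Plane | r < ‖x‖}.indicator (fun x => ‖x‖ₑ ^ (-α)) x
      ∂(counting (Set.range fun n => Y (n + 1) w)) ∂Pr ≠ ∞ := by
    rw [hC]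
    exact ENNReal.mul_ne_top ENNReal.ofReal_ne_top (lintegral_rpow_norm_lt_top hα hr).ne
  have hm := ae_lt_top ((Measure.measurable_lintegral hf).comp h.poisson.measurable) hfin
  filter_upwards [hm, h.ordered, h.ae_norm_station_le] with w hw ho hn hr1
  have hinj : Function.Injective fun n => Y (n + 1) w :=
    (injective_of_strictMono_norm ho).comp (add_left_injective 1)
  have hw : ∫⁻ x, {x : Plane | r < ‖x‖}.indicator (fun x => ‖x‖ₑ ^ (-α)) x
      ∂(counting (Set.range fun n => Y (n + 1) w)) < ∞ := hw
  rw [lintegral_counting (h.poisson.locFin w).countable,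
    tsum_range (fun x : Plane => {x : Plane | r < ‖x‖}.indicator (fun x => ‖x‖ₑ ^ (-α)) x) hinj]
    at hw
  refine ((interference_one_le α K _).trans_lt (lt_of_le_of_lt ?_
    (ENNReal.mul_lt_top (ENNReal.ofReal_lt_top (r := 2 ^ α)) hw))).ne
  rw [← ENNReal.tsum_mul_left]
  refine ENNReal.tsum_le_tsum fun n => ?_
  have hY : r < ‖Y (n + 1) w‖ :=
    hr1.trans_le (ho.monotone (show 1 ≤ n + 1 by omega))
  have hY0 : 0 < ‖Y (n + 1) w‖ := hr.trans hY
  have hU := hn (n + 1)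
  have hU0 : 0 < ‖U (n + 1) w‖ := by linarith
  rw [Set.indicator_of_mem (by exact hY), ← ofReal_norm, ← ofReal_norm,
    ENNReal.ofReal_rpow_of_pos hU0, ENNReal.ofReal_rpow_of_pos hY0,
    ← ENNReal.ofReal_mul (by positivity)]
  refine ENNReal.ofReal_le_ofReal ?_
  rw [Real.rpow_neg hU0.le, Real.rpow_neg hY0.le, ← div_eq_mul_inv, ← Real.div_rpow (by norm_num)
    hY0.le, ← Real.inv_rpow hU0.le]
  refine Real.rpow_le_rpow (by positivity) ?_ (by linarith)
  rw [le_div_iff₀ hY0, inv_mul_le_iff₀ hU0]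
  linarith

/-- The positions of the typical mobile for which the signal lies in a given range. -/
lemma volume_cell_inter_pos {y : ℕ → Plane} (h0 : y 0 = 0) (hy : StrictMono fun n => ‖y n‖)
    {α θ s t : ℝ} (hα : 0 < α) (hθ : 0 < θ) (hs : 0 < s) (hst : s < t)
    (hfar : 2 * (θ * s) ^ (-α⁻¹) < ‖y 1‖) :
    0 < volume (voronoiCell y 0 ∩ {u : Plane | ENNReal.ofReal s ≤ ENNReal.ofReal θ⁻¹ * ‖u‖ₑ ^ (-α) ∧
      ENNReal.ofReal θ⁻¹ * ‖u‖ₑ ^ (-α) < ENNReal.ofReal t}) := by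
  have ht : 0 < t := hs.trans hst
  -- At the radii `a` and `b` the scaled signal equals `t` and `s`. The annulus between them lies in
  -- the cell because every other station is farther than `2 * b`.
  set a := (θ * t) ^ (-α⁻¹) with ha
  set b := (θ * s) ^ (-α⁻¹) with hb
  have ha0 : 0 < a := by positivity
  have hb0 : 0 < b := by positivity
  have hab : a < b := Real.rpow_lt_rpow_of_neg (by positivity)
    (mul_lt_mul_of_pos_left hst hθ) (by simpa using hα)
  have hopen : IsOpen {u : Plane | a < ‖u‖ ∧ ‖u‖ < b} :=
    (isOpen_lt continuous_const continuous_norm).inter (isOpen_lt continuous_norm continuous_const)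
  have hne : {u : Plane | a < ‖u‖ ∧ ‖u‖ < b}.Nonempty := by
    obtain ⟨u, hu⟩ := NormedSpace.exists_lt_norm ℝ Plane 0
    refine ⟨((a + b) / 2 / ‖u‖) • u, ?_⟩
    have : ‖((a + b) / 2 / ‖u‖) • u‖ = (a + b) / 2 := by
      rw [norm_smul, Real.norm_of_nonneg (by positivity), div_mul_cancel₀ _ hu.ne']
    change a < ‖_‖ ∧ ‖_‖ < b
    rw [this]
    constructor <;> linarith
  refine (hopen.measure_pos volume hne).trans_le (measure_mono ?_)
  rintro u ⟨hau, hub⟩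
  have hu0 : 0 < ‖u‖ := ha0.trans hau
  have hpow (x : ℝ) (hx : 0 < x) : (x ^ (-α⁻¹)) ^ (-α) = x := by
    rw [← Real.rpow_mul hx.le, neg_mul_neg, inv_mul_cancel₀ hα.ne', Real.rpow_one]
  refine ⟨fun m => ?_, ?_, ?_⟩
  · rcases Nat.eq_zero_or_pos m with rfl | hm
    · exact le_rfl
    · rw [h0, dist_zero_right]
      have h1 : ‖y 1‖ ≤ ‖y m‖ := hy.monotone hm
      have h3 := norm_sub_norm_le (y m) u
      rw [← dist_eq_norm, dist_comm] at h3
      linarith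
  · rw [← ofReal_norm, ENNReal.ofReal_rpow_of_pos hu0,
      ← ENNReal.ofReal_mul (by positivity)]
    refine ENNReal.ofReal_le_ofReal ?_
    rw [le_inv_mul_iff₀ hθ, ← hpow (θ * s) (by positivity)]
    exact Real.rpow_le_rpow_of_nonpos hu0 hub.le (by linarith)
  · rw [← ofReal_norm, ENNReal.ofReal_rpow_of_pos hu0,
      ← ENNReal.ofReal_mul (by positivity), ENNReal.ofReal_lt_ofReal_iff ht, inv_mul_lt_iff₀ hθ,
      ← hpow (θ * t) (by positivity)]
    exact Real.rpow_lt_rpow_of_neg ha0 hau (by linarith)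

/-- The probability of a weak signal is strictly increasing in the noise power. -/
theorem measure_weakSignal_lt [IsProbabilityMeasure Pr] (h : IsCellularNetwork Pr dens Y U) (hd : 0 ≤ dens) {α θ μ x : ℝ}
    (hα : 2 < α) (hθ : 0 < θ) (hμ : 0 < μ) (hx : μ < x) (K : ℕ) :
    Pr {w | (fun n => U n w) ∈ weakSignal α θ K μ} <
      Pr {w | (fun n => U n w) ∈ weakSignal α θ K x} := by
  -- The signal window used below starts at some `s ≥ μ`, so stations beyond this `r` leave its
  -- whole annulus inside the typical cell.
  set r := 2 * (θ * μ) ^ (-α⁻¹) with hr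
  have hr0 : 0 < r := by positivity
  set A : Set (ℕ → Plane) := {y | r < ‖y 1‖} with hA
  have hAm : MeasurableSet A := measurableSet_lt measurable_const (measurable_pi_apply 1).norm
  set J : (ℕ → Plane) → ℝ≥0∞ := fun v => interference α K 1 (fun n => n.casesOn 0 v) with hJ
  have hJm : Measurable J := by
    refine (measurable_interference α K 1).comp (measurable_pi_lambda _ ?_)
    rintro (_ | n)
    · exact measurable_const
    · exact measurable_pi_apply n
  have hJU (w : Ω) : interference α K 1 (fun n => U n w) = J fun n => U (n + 1) w := by
    refine interference_congr fun n hn => ?_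
    obtain ⟨m, rfl⟩ := Nat.exists_eq_add_of_le' hn
    rfl
  -- Windows of interference of length `δ`, half of the gap, leave a signal window of length `δ`
  -- below.
  set δ : ℝ := (x - μ) / 2 with hδ
  have hδ0 : 0 < δ := by rw [hδ]; linarith
  let C : ℕ → Set (ℕ → Plane) := fun k =>
    {v | ENNReal.ofReal (k * δ) ≤ J v ∧ J v < ENNReal.ofReal ((k + 1) * δ)}
  have hCm (k : ℕ) : MeasurableSet (C k) :=
    (measurableSet_le measurable_const hJm).inter (measurableSet_lt hJm measurable_const)
  -- some small range of values of the interference has positive probability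
  obtain ⟨k, hk⟩ : ∃ k, 0 < Pr {w | (fun n => Y n w) ∈ A ∧ (fun n => U (n + 1) w) ∈ C k} := by
    by_contra! hall
    have h1 : Pr (⋃ k, {w | (fun n => Y n w) ∈ A ∧ (fun n => U (n + 1) w) ∈ C k}) = 0 :=
      measure_iUnion_null fun k => le_antisymm (hall k) (zero_le)
    refine (h.measure_far_pos r).ne' ?_
    refine measure_mono_null_ae ?_ h1
    filter_upwards [h.ae_interference_ne_top hd hα hr0 K] with w hw hwA
    have hw := hw hwA
    rw [hJU] at hw
    refine Set.mem_iUnion.2 ⟨⌊(J fun n => U (n + 1) w).toReal / δ⌋₊, hwA, ?_, ?_⟩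
    · refine ENNReal.ofReal_le_of_le_toReal ?_
      rw [← le_div_iff₀ hδ0]
      exact Nat.floor_le (by positivity)
    · refine (ENNReal.lt_ofReal_iff_toReal_lt hw).2 ?_
      rw [← div_lt_iff₀ hδ0]
      exact Nat.lt_floor_add_one _
  -- With interference in `[k * δ, (k + 1) * δ)`, a signal in `[s, t)` is weak for noise `x` but not
  -- for noise `μ`. Given the stations and the interferers, such a signal has positive probability.
  set s : ℝ := (k + 1) * δ + μ with hs
  set t : ℝ := k * δ + x with ht
  have hst : s < t := by rw [hs, ht]; linarith
  have hμs : μ ≤ s := by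
    have : 0 ≤ (k + 1) * δ := by positivity
    linarith
  have hs0 : 0 < s := hμ.trans_le hμs
  set B₀ : Set Plane := {u | ENNReal.ofReal s ≤ ENNReal.ofReal θ⁻¹ * ‖u‖ₑ ^ (-α) ∧
      ENNReal.ofReal θ⁻¹ * ‖u‖ₑ ^ (-α) < ENNReal.ofReal t} with hB₀
  have hf : Measurable fun u : Plane => ENNReal.ofReal θ⁻¹ * ‖u‖ₑ ^ (-α) :=
    (measurable_enorm.pow_const _).const_mul _
  have hB₀m : MeasurableSet B₀ :=
    (measurableSet_le measurable_const hf).inter (measurableSet_lt hf measurable_const)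
  have hpos : 0 < Pr {w | (fun n => Y n w) ∈ A ∧ U 0 w ∈ B₀ ∧ (fun n => U (n + 1) w) ∈ C k} := by
    rw [h.measure_typical_mobile hAm (hCm k) hB₀m, pos_iff_ne_zero]
    intro h0
    have hE : MeasurableSet {w | (fun n => Y n w) ∈ A ∧ (fun n => U (n + 1) w) ∈ C k} :=
      (h.measurable_stations hAm).inter
        ((measurable_pi_lambda _ fun n => h.measurable_mobile (n + 1)) (hCm k))
    have hg : Measurable fun w => (volume[|voronoiCell (fun n => Y n w) 0]) B₀ :=
      (measurable_cond_voronoiCell 0 hB₀m).comp h.measurable_stations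
    rw [lintegral_eq_zero_iff hg, Filter.EventuallyEq, ae_restrict_iff' hE] at h0
    refine hk.ne' (measure_mono_null_ae (t := ∅) ?_ measure_empty)
    filter_upwards [h0, h.ordered, h.ae_volume_voronoiCell_ne_top] with w hw ho htop hwE
    have hw := hw hwE
    rw [Pi.zero_apply] at hw
    change (volume[|voronoiCell (fun n => Y n w) 0]) B₀ = 0 at hw
    rw [cond_apply (measurableSet_voronoiCell _ _), mul_eq_zero, ENNReal.inv_eq_zero] at hw
    have hfar : 2 * (θ * s) ^ (-α⁻¹) < ‖Y 1 w‖ := by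
      refine lt_of_le_of_lt ?_ (show r < ‖Y 1 w‖ from hwE.1)
      rw [hr]
      refine mul_le_mul_of_nonneg_left ?_ (by norm_num)
      exact Real.rpow_le_rpow_of_nonpos (by positivity) (mul_le_mul_of_nonneg_left hμs hθ.le)
        (by simp; linarith)
    rcases hw with hw | hw
    · exact htop hw
    · exact (volume_cell_inter_pos (y := fun n => Y n w) (h.typical w) ho (by linarith) hθ hs0 hst
        hfar).ne' hw
  have hWm (z : ℝ) : MeasurableSet {w | (fun n => U n w) ∈ weakSignal α θ K z} :=
    h.measurable_mobiles (measurableSet_weakSignal α θ K z)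
  have hsub : {w | (fun n => Y n w) ∈ A ∧ U 0 w ∈ B₀ ∧ (fun n => U (n + 1) w) ∈ C k} ⊆
      {w | (fun n => U n w) ∈ weakSignal α θ K x} \
        {w | (fun n => U n w) ∈ weakSignal α θ K μ} := by
    rintro w ⟨-, ⟨hB1, hB2⟩, hC1, hC2⟩
    rw [← hJU] at hC1 hC2
    constructor
    · change ENNReal.ofReal θ⁻¹ * ‖U 0 w‖ₑ ^ (-α) <
        interference α K 1 (fun n => U n w) + ENNReal.ofReal x
      refine hB2.trans_le ?_
      rw [ht, ENNReal.ofReal_add (by positivity) (by linarith)]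
      exact add_le_add_left hC1 _
    · change ¬ (ENNReal.ofReal θ⁻¹ * ‖U 0 w‖ₑ ^ (-α) <
        interference α K 1 (fun n => U n w) + ENNReal.ofReal μ)
      rw [not_lt]
      refine le_trans ?_ hB1
      rw [hs, ENNReal.ofReal_add (by positivity) hμ.le]
      exact add_le_add_left hC2.le _
  have hmono : {w | (fun n => U n w) ∈ weakSignal α θ K μ} ⊆
      {w | (fun n => U n w) ∈ weakSignal α θ K x} := fun w hw => weakSignal_mono α θ K hx.le hw
  rw [← measure_sdiff_add_inter (μ := Pr) {w | (fun n => U n w) ∈ weakSignal α θ K x} (hWm μ),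
    Set.inter_eq_right.2 hmono, add_comm]
  exact ENNReal.lt_add_right (measure_ne_top _ _) (hpos.trans_le (measure_mono hsub)).ne'

/-- The outage constraint is a lower bound on the transmission power. -/
theorem outage_le_iff [IsProbabilityMeasure Pr] (h : IsCellularNetwork Pr 1 Y U) {α σ θ ε μ : ℝ} (hα : 2 < α) (hσ : 0 < σ)
    (hθ : 0 < θ) (hε : ε < 1) (hμ : 0 < μ) (K : ℕ)
    (hout : Pr {w | (fun n => U n w) ∈ weakSignal α θ K μ} = ENNReal.ofReal ε)
    {Ω' : Type*} [MeasurableSpace Ω'] {Pr' : Measure Ω'} [IsProbabilityMeasure Pr'] {b : ℝ}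
    (hb : 0 < b) {Y' U' : ℕ → Ω' → Plane} (h' : IsCellularNetwork Pr' b Y' U') {p : ℝ}
    (hp : 0 ≤ p) :
    Pr' {w | sinr α σ K p (fun n => U' n w) < ENNReal.ofReal θ} ≤ ENNReal.ofReal ε ↔
      σ ^ 2 / μ ≤ p * b ^ (α / 2) := by
  have hb2 : 0 < b ^ (α / 2) := Real.rpow_pos_of_pos hb _
  rcases hp.eq_or_lt with rfl | hp
  -- At zero power outage is certain, so both sides fail.
  · have : {w | sinr α σ K 0 (fun n => U' n w) < ENNReal.ofReal θ} = Set.univ := by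
      ext w
      simp [sinr, hθ]
    rw [this, measure_univ, zero_mul]
    constructor
    · intro hle
      exact absurd hle (not_le.2 (by simpa using hε))
    · intro hle
      exact absurd hle (not_le.2 (by positivity))
  · have hc : 0 < √b := Real.sqrt_pos.2 hb
    have hs := h'.smul hc
    rw [Real.sq_sqrt hb.le, div_self hb.ne'] at hs
    have hlaw := congrArg (fun M => M (Prod.snd ⁻¹' weakSignal α θ K (σ ^ 2 / (p * b ^ (α / 2)))))
      (hs.map_eq h)
    have hWm := (measurable_snd : Measurable (Prod.snd : (ℕ → Plane) × (ℕ → Plane) → ℕ → Plane))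
      (measurableSet_weakSignal α θ K (σ ^ 2 / (p * b ^ (α / 2))))
    rw [Measure.map_apply (hs.measurable_stations.prodMk hs.measurable_mobiles) hWm,
      Measure.map_apply (h.measurable_stations.prodMk h.measurable_mobiles) hWm] at hlaw
    have e : Pr' {w | sinr α σ K p (fun n => U' n w) < ENNReal.ofReal θ} =
        Pr {w | (fun n => U n w) ∈ weakSignal α θ K (σ ^ 2 / (p * b ^ (α / 2)))} := by
      refine Eq.trans (measure_congr ?_) hlaw
      filter_upwards [h'.ae_mobile_ne_zero] with w hw
      exact propext (sinr_lt_iff hσ hθ hp hb K (u := fun n => U' n w) hw)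
    rw [e, ← hout, div_le_comm₀ hμ (by positivity)]
    constructor
    · intro hle
      by_contra! hlt
      exact absurd hle (not_le.2 (h.measure_weakSignal_lt zero_le_one hα hθ hμ hlt K))
    · intro hle
      exact measure_mono fun w hw => weakSignal_mono α θ K hle hw

end IsCellularNetwork


/-! ### Energy storage along a fixed sequence of slots -/

section Storage

/-- The energy in a storage, driven by the sequence of pairs of an activity flag and an amount of
harvested energy. -/
noncomputable def stored (p : ℝ) (z : ℕ → Bool × ℝ≥0∞) : ℕ → ℝ≥0∞
  | 0 => 0
  | t + 1 => (if (z t).1 = true ∧ ENNReal.ofReal p ≤ stored p z t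
      then stored p z t - ENNReal.ofReal p else stored p z t) + (z t).2

open scoped Classical in
/-- The number of transmissions in the first `n` slots. -/
noncomputable def transmissions (p : ℝ) (z : ℕ → Bool × ℝ≥0∞) (n : ℕ) : ℕ :=
  ∑ t ∈ Finset.range n, if (z t).1 = true ∧ ENNReal.ofReal p ≤ stored p z t then 1 else 0

/-- The number of active slots among the first `n`. -/
def activity (z : ℕ → Bool × ℝ≥0∞) (n : ℕ) : ℕ :=
  ∑ t ∈ Finset.range n, if (z t).1 = true then 1 else 0

lemma stored_congr {p : ℝ} {z z' : ℕ → Bool × ℝ≥0∞} {n : ℕ} (h : ∀ t < n, z t = z' t) :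
    stored p z n = stored p z' n := by
  induction n with
  | zero => rfl
  | succ n ih =>
    have := ih fun t ht => h t (by omega)
    simp only [stored, this, h n (Nat.lt_succ_self n)]

lemma measurable_stored (p : ℝ) (n : ℕ) :
    Measurable fun z : ℕ → Bool × ℝ≥0∞ => stored p z n := by
  induction n with
  | zero => exact measurable_const
  | succ n ih =>
    have hn : Measurable fun z : ℕ → Bool × ℝ≥0∞ => z n := measurable_pi_apply n
    refine Measurable.add (Measurable.ite ?_ (ih.sub measurable_const) ih) hn.snd
    exact (hn.fst (measurableSet_singleton true)).inter (measurableSet_le measurable_const ih)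

/-- Conservation of energy: what is stored plus what was spent is what was harvested. -/
lemma stored_add_transmissions (p : ℝ) (z : ℕ → Bool × ℝ≥0∞) (n : ℕ) :
    stored p z n + ENNReal.ofReal p * transmissions p z n = ∑ t ∈ Finset.range n, (z t).2 := by
  induction n with
  | zero => simp [stored, transmissions]
  | succ n ih =>
    rw [Finset.sum_range_succ, ← ih, transmissions, Finset.sum_range_succ, ← transmissions, stored]
    split_ifs with h
    · push_cast
      rw [mul_add, mul_one]
      conv_rhs => rw [← tsub_add_cancel_of_le h.2]
      ring
    · push_cast
      ring

lemma transmissions_le_activity (p : ℝ) (z : ℕ → Bool × ℝ≥0∞) (n : ℕ) :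
    transmissions p z n ≤ activity z n := by
  refine Finset.sum_le_sum fun t _ => ?_
  split_ifs with h1 h2 h2
  · exact le_rfl
  · exact absurd h1.1 h2
  · exact zero_le_one
  · exact le_rfl

lemma activity_le (z : ℕ → Bool × ℝ≥0∞) (n : ℕ) : activity z n ≤ n := by
  refine (Finset.sum_le_card_nsmul _ _ 1 fun t _ => ?_).trans (by simp)
  split_ifs <;> simp

/-- The number of transmissions is limited only by the energy harvested up to some time and by the
activity from then on. -/
lemma exists_le_transmissions {p : ℝ} (hp : 0 < p) {z : ℕ → Bool × ℝ≥0∞} {e : ℕ → ℝ}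
    (he : ∀ t, 0 ≤ e t) (hez : ∀ t, ENNReal.ofReal (e t) ≤ (z t).2) (n : ℕ) :
    ∃ k ≤ n, ∑ t ∈ Finset.range k, e t + p * ((activity z n : ℝ) - activity z k) - 2 * p ≤
      p * transmissions p z n := by
  induction n with
  | zero => exact ⟨0, le_rfl, by simp [transmissions]; linarith⟩
  | succ n ih =>
    have hT : transmissions p z n ≤ transmissions p z (n + 1) := by
      rw [transmissions, transmissions, Finset.sum_range_succ]
      omega
    have hA : activity z (n + 1) = activity z n + if (z n).1 = true then 1 else 0 := by
      rw [activity, Finset.sum_range_succ]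
      rfl
    -- With enough energy, slot `n` adds equally to transmissions and activity, and the old `k`
    -- still works; otherwise `k` restarts at `n`.
    by_cases hS : ENNReal.ofReal p ≤ stored p z n
    · obtain ⟨k, hk, h⟩ := ih
      refine ⟨k, by omega, ?_⟩
      have hT' : transmissions p z (n + 1) =
          transmissions p z n + if (z n).1 = true then 1 else 0 := by
        rw [transmissions, Finset.sum_range_succ]
        simp only [hS, and_true]
        rfl
      rw [hT', hA]
      push_cast
      linarith
    · refine ⟨n, by omega, ?_⟩
      -- Less than `p` is left, so almost all harvested energy was spent. This costs one `p`, and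
      -- the possibly active slot `n` costs the other in `2 * p`.
      have h1 : ENNReal.ofReal (∑ t ∈ Finset.range n, e t) ≤
          ENNReal.ofReal (p + p * transmissions p z n) := by
        rw [ENNReal.ofReal_sum_of_nonneg fun t _ => he t, ENNReal.ofReal_add hp.le (by positivity),
          ENNReal.ofReal_mul hp.le, ENNReal.ofReal_natCast]
        refine (Finset.sum_le_sum fun t _ => hez t).trans ?_
        rw [← stored_add_transmissions p z n]
        gcongr
        exact (not_le.1 hS).le
      have h2 := (ENNReal.ofReal_le_ofReal_iff (by positivity)).1 h1
      have h3 : (activity z (n + 1) : ℝ) - activity z n ≤ 1 := by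
        rw [hA]
        split_ifs <;> simp
      have h4 : (transmissions p z n : ℝ) ≤ transmissions p z (n + 1) := by exact_mod_cast hT
      have h5 := mul_le_mul_of_nonneg_left h3 hp.le
      have h6 := mul_le_mul_of_nonneg_left h4 hp.le
      linarith

/-- Convergence of averages controls all partial sums. -/
lemma eventually_forall_abs_sub_le {s : ℕ → ℝ} {m : ℝ} (h : Tendsto (fun n : ℕ => s n / n) atTop (𝓝 m))
    {r : ℝ} (hr : 0 < r) : ∀ᶠ n : ℕ in atTop, ∀ k ≤ n, |s k - m * k| ≤ r * n := by
  obtain ⟨n₀, hn₀⟩ := Metric.tendsto_atTop.1 h r hr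
  obtain ⟨b, hb⟩ : ∃ b : ℝ, ∀ k ≤ n₀, |s k - m * k| ≤ b := by
    refine ⟨∑ k ∈ Finset.range (n₀ + 1), |s k - m * k|, fun k hk => ?_⟩
    exact Finset.single_le_sum (f := fun k : ℕ => |s k - m * k|) (fun i _ => abs_nonneg _)
      (Finset.mem_range.2 (by omega))
  obtain ⟨n₁, hn₁⟩ := exists_nat_ge (b / r)
  filter_upwards [eventually_ge_atTop n₁] with n hn k hk
  by_cases hk0 : k ≤ n₀
  -- The finitely many small `k` have bounded error, which `r * n` dominates for large `n`.
  · refine (hb k hk0).trans ?_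
    rw [div_le_iff₀ hr] at hn₁
    have : (n₁ : ℝ) ≤ n := by exact_mod_cast hn
    nlinarith
  · have hkpos : (0 : ℝ) < k := by exact_mod_cast (by omega : 0 < k)
    have h1 := hn₀ k (by omega)
    rw [Real.dist_eq] at h1
    have e : s k - m * k = (s k / k - m) * k := by field_simp
    rw [e, abs_mul, abs_of_pos hkpos]
    have : (k : ℝ) ≤ n := by exact_mod_cast hk
    exact mul_le_mul h1.le this hkpos.le hr.le

/-- If the harvest rate covers the consumption, a transmission takes place in almost every active
slot. -/
lemma tendsto_transmissions {p : ℝ} (hp : 0 < p) {z : ℕ → Bool × ℝ≥0∞} {e : ℕ → ℝ}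
    (he : ∀ t, 0 ≤ e t) (hez : ∀ t, ENNReal.ofReal (e t) ≤ (z t).2) {m ω : ℝ}
    (hm : Tendsto (fun n : ℕ => (∑ t ∈ Finset.range n, e t) / n) atTop (𝓝 m))
    (hω : Tendsto (fun n : ℕ => (activity z n : ℝ) / n) atTop (𝓝 ω)) (hmω : ω * p ≤ m) :
    Tendsto (fun n : ℕ => (transmissions p z n : ℝ) / n) atTop (𝓝 ω) := by
  rw [tendsto_order]
  constructor
  · intro x hx
    -- The deviations add up to `r * (1 + 2 * p) * n`, half of the margin `(ω - x) * p * n`; the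
    -- choice of `n₁` makes the other half exceed `2 * p`.
    set r := (ω - x) * p / (2 * (1 + 2 * p)) with hr
    have hr0 : 0 < r := by
      have : 0 < ω - x := by linarith
      positivity
    obtain ⟨n₁, hn₁⟩ := exists_nat_gt (4 / (ω - x))
    filter_upwards [eventually_forall_abs_sub_le hm hr0, eventually_forall_abs_sub_le hω hr0,
      eventually_ge_atTop n₁, eventually_gt_atTop 0] with n h1 h2 h3 h4
    have hn : (0 : ℝ) < n := by exact_mod_cast h4
    obtain ⟨k, hk, h⟩ := exists_le_transmissions hp he hez n
    have a1 := (abs_le.1 (h1 k hk)).1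
    have a2 := (abs_le.1 (h2 k hk)).2
    have a3 := (abs_le.1 (h2 n le_rfl)).1
    have a4 : (ω * p) * k ≤ m * k := mul_le_mul_of_nonneg_right hmω (by positivity)
    have a5 := mul_le_mul_of_nonneg_left a2 hp.le
    have a6 := mul_le_mul_of_nonneg_left a3 hp.le
    rw [lt_div_iff₀ hn]
    have a7 : 4 < n * (ω - x) := by
      have : (n₁ : ℝ) ≤ n := by exact_mod_cast h3
      rw [← div_lt_iff₀ (by linarith)]
      linarith
    have a8 : r * (1 + 2 * p) * n = (ω - x) * p * n / 2 := by
      rw [hr]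
      field_simp
    have a9 : p * (ω * n) - r * (1 + 2 * p) * n - 2 * p ≤ p * transmissions p z n := by
      nlinarith
    have a10 : p * 4 < p * (n * (ω - x)) := mul_lt_mul_of_pos_left a7 hp
    have : p * (x * n) < p * transmissions p z n := by nlinarith
    exact lt_of_mul_lt_mul_left this hp.le
  · intro x hx
    filter_upwards [(tendsto_order.1 hω).2 x hx] with n hn
    refine lt_of_le_of_lt ?_ hn
    gcongr
    exact transmissions_le_activity p z n

end Storage

/-! ### Long-run availability of energy with independent slots -/

section Random

variable {Ω : Type*} [MeasurableSpace Ω] {Pr : Measure Ω}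
  {W : ℕ → Ω → Bool × ℝ≥0∞} {ω p : ℝ}

lemma measurable_stored_comp (hW : ∀ t, Measurable (W t)) (n : ℕ) :
    Measurable fun w => stored p (fun t => W t w) n :=
  (measurable_stored p n).comp (measurable_pi_lambda _ hW)

/-- The activity in a slot is independent of the energy stored at its beginning. -/
lemma measureReal_active_inter (hW : ∀ t, Measurable (W t)) (hind : iIndepFun W Pr)
    (hω : 0 ≤ ω) (hact : ∀ t, Pr {w | (W t w).1 = true} = ENNReal.ofReal ω) (n : ℕ) :
    Pr.real {w | (W n w).1 = true ∧ ENNReal.ofReal p ≤ stored p (fun t => W t w) n} =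
      ω * Pr.real {w | ENNReal.ofReal p ≤ stored p (fun t => W t w) n} := by
  have hi := hind.indepFun_finset {n} (Finset.range n) (by simp) hW
  -- The energy at the start of slot `n` depends on earlier slots only; the filler `(false, 0)` for
  -- the others is irrelevant.
  let g : (Finset.range n → Bool × ℝ≥0∞) → ℝ≥0∞ := fun v =>
    stored p (fun t => if h : t ∈ Finset.range n then v ⟨t, h⟩ else (false, 0)) n
  have hg : Measurable g := by
    refine (measurable_stored p n).comp (measurable_pi_lambda _ fun t => ?_)
    by_cases h : t ∈ Finset.range n
    · simp only [h, dite_true]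
      exact measurable_pi_apply _
    · simp only [h, dite_false]
      exact measurable_const
  have hgS (w : Ω) : g (fun i => W i w) = stored p (fun t => W t w) n := by
    refine stored_congr fun t ht => ?_
    simp [ht]
  have hA : MeasurableSet {v : (({n} : Finset ℕ) → Bool × ℝ≥0∞) |
      (v ⟨n, Finset.mem_singleton_self n⟩).1 = true} :=
    (measurable_pi_apply _).fst (measurableSet_singleton true)
  have hB : MeasurableSet {v | ENNReal.ofReal p ≤ g v} := measurableSet_le measurable_const hg
  have := hi.measure_inter_preimage_eq_mul _ _ hA hB
  have e2 : (fun w (i : Finset.range n) => W i w) ⁻¹' {v | ENNReal.ofReal p ≤ g v} =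
      {w | ENNReal.ofReal p ≤ stored p (fun t => W t w) n} := by
    ext w
    change ENNReal.ofReal p ≤ g (fun i => W i w) ↔
      ENNReal.ofReal p ≤ stored p (fun t => W t w) n
    rw [hgS]
  rw [e2] at this
  have h3 : Pr {w | (W n w).1 = true ∧ ENNReal.ofReal p ≤ stored p (fun t => W t w) n} =
      ENNReal.ofReal ω * Pr {w | ENNReal.ofReal p ≤ stored p (fun t => W t w) n} := by
    rw [← hact n]
    exact this
  rw [Measure.real, h3, ENNReal.toReal_mul, ENNReal.toReal_ofReal hω]
  rfl

lemma measurable_transmissions (hW : ∀ t, Measurable (W t)) (n : ℕ) :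
    Measurable fun w => (transmissions p (fun t => W t w) n : ℝ) := by
  unfold transmissions
  push_cast
  refine Finset.measurable_sum _ fun t _ => Measurable.ite ?_ measurable_const measurable_const
  exact ((hW t).fst (measurableSet_singleton true)).inter
    (measurableSet_le measurable_const (measurable_stored_comp hW t))

lemma integral_transmissions [IsProbabilityMeasure Pr] (hW : ∀ t, Measurable (W t)) (hind : iIndepFun W Pr)
    (hω : 0 ≤ ω) (hact : ∀ t, Pr {w | (W t w).1 = true} = ENNReal.ofReal ω) (n : ℕ) :
    ∫ w, (transmissions p (fun t => W t w) n : ℝ) ∂Pr = ω * ∑ t ∈ Finset.range n,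
      Pr.real {w | ENNReal.ofReal p ≤ stored p (fun t => W t w) t} := by
  classical
  have hm (t : ℕ) : MeasurableSet
      {w | (W t w).1 = true ∧ ENNReal.ofReal p ≤ stored p (fun t => W t w) t} :=
    ((hW t).fst (measurableSet_singleton true)).inter
      (measurableSet_le measurable_const (measurable_stored_comp hW t))
  have e (w : Ω) : (transmissions p (fun t => W t w) n : ℝ) = ∑ t ∈ Finset.range n,
      {w | (W t w).1 = true ∧ ENNReal.ofReal p ≤ stored p (fun t => W t w) t}.indicator
        (fun _ => (1 : ℝ)) w := by
    unfold transmissions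
    push_cast
    refine Finset.sum_congr rfl fun t _ => ?_
    rw [Set.indicator_apply]
    rfl
  simp_rw [e]
  rw [integral_finsetSum _ fun t _ => (integrable_const 1).indicator (hm t), Finset.mul_sum]
  refine Finset.sum_congr rfl fun t _ => ?_
  rw [integral_indicator_const _ (hm t), smul_eq_mul, mul_one,
    measureReal_active_inter hW hind hω hact]

/-- If the mean harvest, bounded from below by `f`, covers the mean consumption, there is almost
always enough energy. -/
theorem tendsto_average_of_le [IsProbabilityMeasure Pr] {f : ℕ → Ω → ℝ≥0∞} (hp : 0 < p) (hW : ∀ t, Measurable (W t))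
    (hind : iIndepFun W Pr) (hω : 0 < ω)
    (hact : ∀ t, Pr {w | (W t w).1 = true} = ENNReal.ofReal ω)
    (hf : ∀ t, Measurable (f t)) (hfi : iIndepFun f Pr) (hfd : ∀ t, Pr.map (f t) = Pr.map (f 0))
    (hfW : ∀ t w, f t w ≤ (W t w).2) (hfin : ∫⁻ w, f 0 w ∂Pr ≠ ∞)
    (hle : ENNReal.ofReal (ω * p) ≤ ∫⁻ w, f 0 w ∂Pr) :
    Tendsto (fun n : ℕ => (∑ t ∈ Finset.range n,
      Pr.real {w | ENNReal.ofReal p ≤ stored p (fun t => W t w) t}) / (n : ℝ)) atTop (𝓝 1) := by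
  classical
  -- the law of large numbers for the harvest
  have hL1 := strong_law_ae_real (μ := Pr) (fun t w => (f t w).toReal)
    (integrable_toReal_of_lintegral_ne_top (hf 0).aemeasurable hfin)
    (fun i j hij => (hfi.indepFun hij).comp ENNReal.measurable_toReal ENNReal.measurable_toReal)
    (fun t => (IdentDistrib.mk (hf t).aemeasurable (hf 0).aemeasurable (hfd t)).comp
      ENNReal.measurable_toReal)
  -- the law of large numbers for the activity
  let ind : Bool × ℝ≥0∞ → ℝ := fun x => if x.1 = true then 1 else 0
  have hindm : Measurable ind :=
    Measurable.ite (measurable_fst (measurableSet_singleton true)) measurable_const measurable_const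
  have hmA (t : ℕ) : MeasurableSet {w | (W t w).1 = true} :=
    (hW t).fst (measurableSet_singleton true)
  have hmap (t : ℕ) : Pr.map (fun w => (W t w).1) = Pr.map (fun w => (W 0 w).1) := by
    have h1 := Measure.isProbabilityMeasure_map (μ := Pr) (hW t).fst.aemeasurable
    have h2 := Measure.isProbabilityMeasure_map (μ := Pr) (hW 0).fst.aemeasurable
    have hv (t : ℕ) : Pr.map (fun w => (W t w).1) {true} = ENNReal.ofReal ω := by
      rw [Measure.map_apply (hW t).fst (measurableSet_singleton true)]
      exact hact t
    have hv' (t : ℕ) : Pr.map (fun w => (W t w).1) {false} = 1 - ENNReal.ofReal ω := by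
      have := Measure.isProbabilityMeasure_map (μ := Pr) (hW t).fst.aemeasurable
      rw [← hv t, ← prob_compl_eq_one_sub (measurableSet_singleton true)]
      congr 1
      ext b
      cases b <;> simp
    refine Measure.ext_of_singleton fun b => ?_
    cases b
    · rw [hv', hv']
    · rw [hv, hv]
  have hL2 := strong_law_ae_real (μ := Pr) (fun t w => ind (W t w))
    (Integrable.of_bound (hindm.comp (hW 0)).aestronglyMeasurable 1
      (ae_of_all _ fun w => by simp only [ind]; split_ifs <;> simp))
    (fun i j hij => (hind.indepFun hij).comp hindm hindm)
    (fun t => (IdentDistrib.mk (hW t).fst.aemeasurable (hW 0).fst.aemeasurable (hmap t)).comp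
      (u := fun b : Bool => if b = true then (1 : ℝ) else 0) (measurable_of_countable _))
  have hm2 : ∫ w, ind (W 0 w) ∂Pr = ω := by
    have : (fun w => ind (W 0 w)) = {w | (W 0 w).1 = true}.indicator (fun _ => (1 : ℝ)) := by
      ext w
      rw [Set.indicator_apply]
      rfl
    rw [this, integral_indicator_const _ (hmA 0), smul_eq_mul, mul_one, Measure.real, hact,
      ENNReal.toReal_ofReal hω.le]
  have hm1 : ω * p ≤ ∫ w, (f 0 w).toReal ∂Pr := by
    rw [integral_toReal (hf 0).aemeasurable (ae_lt_top (hf 0) hfin)]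
    exact (ENNReal.ofReal_le_iff_le_toReal hfin).1 hle
  have hae : ∀ᵐ w ∂Pr, Tendsto (fun n : ℕ => (transmissions p (fun t => W t w) n : ℝ) / n)
      atTop (𝓝 ω) := by
    filter_upwards [hL1, hL2] with w h1 h2
    refine tendsto_transmissions hp (e := fun t => (f t w).toReal)
      (fun t => ENNReal.toReal_nonneg)
      (fun t => ENNReal.ofReal_toReal_le.trans (hfW t w)) h1 ?_ hm1
    rw [hm2] at h2
    refine h2.congr fun n => ?_
    unfold activity
    push_cast
    rfl
  -- Dominated convergence passes from the almost sure frequency to its mean, which is `ω` times the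
  -- average in question.
  have hT : Tendsto (fun n : ℕ => ∫ w, (transmissions p (fun t => W t w) n : ℝ) / n ∂Pr) atTop
      (𝓝 (∫ _w, ω ∂Pr)) := by
    refine tendsto_integral_of_dominated_convergence (fun _ => 1)
      (fun n => ((measurable_transmissions hW n).div_const _).aestronglyMeasurable)
      (integrable_const _) (fun n => ae_of_all _ fun w => ?_) hae
    rw [Real.norm_of_nonneg (by positivity)]
    refine div_le_one_of_le₀ ?_ (by positivity)
    exact_mod_cast (transmissions_le_activity p _ n).trans (activity_le _ n)
  have hT' := hT.div_const ω
  simp_rw [integral_div, integral_transmissions hW hind hω.le hact] at hT'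
  rw [integral_const, probReal_univ, one_smul, div_self hω.ne'] at hT'
  refine hT'.congr fun n => ?_
  field_simp

/-- The mean consumption cannot exceed the mean harvest. -/
theorem le_lintegral_of_tendsto_average [IsProbabilityMeasure Pr] (hp : 0 < p) (hW : ∀ t, Measurable (W t))
    (hind : iIndepFun W Pr) (hω : 0 < ω)
    (hact : ∀ t, Pr {w | (W t w).1 = true} = ENNReal.ofReal ω) {m : ℝ≥0∞}
    (hm : ∀ t, ∫⁻ w, (W t w).2 ∂Pr = m)
    (h : Tendsto (fun n : ℕ => (∑ t ∈ Finset.range n,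
      Pr.real {w | ENNReal.ofReal p ≤ stored p (fun t => W t w) t}) / (n : ℝ)) atTop (𝓝 1)) :
    ENNReal.ofReal (ω * p) ≤ m := by
  by_cases hm' : m = ∞
  · simp [hm']
  refine ENNReal.ofReal_le_of_le_toReal ?_
  have h' := h.const_mul (ω * p)
  rw [mul_one] at h'
  refine le_of_tendsto h' ?_
  filter_upwards [eventually_gt_atTop 0] with n hn
  have hn : (0 : ℝ) < n := by exact_mod_cast hn
  -- On average no more energy is spent than harvested in `n` slots.
  have h1 : ENNReal.ofReal p * ∫⁻ w, ENNReal.ofReal (transmissions p (fun t => W t w) n) ∂Pr ≤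
      n * m := by
    rw [← lintegral_const_mul' _ _ ENNReal.ofReal_ne_top]
    calc _ ≤ ∫⁻ w, ∑ t ∈ Finset.range n, (W t w).2 ∂Pr := by
          refine lintegral_mono fun w => ?_
          rw [← stored_add_transmissions p, ENNReal.ofReal_natCast]
          exact le_add_self
      _ = n * m := by
          rw [lintegral_finsetSum _ fun t _ => (hW t).snd]
          simp [hm]
  have hi : Integrable (fun w => (transmissions p (fun t => W t w) n : ℝ)) Pr := by
    refine Integrable.of_bound (measurable_transmissions hW n).aestronglyMeasurable n
      (ae_of_all _ fun w => ?_)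
    rw [Real.norm_of_nonneg (by positivity)]
    exact_mod_cast (transmissions_le_activity p _ n).trans (activity_le _ n)
  rw [← ofReal_integral_eq_lintegral_ofReal hi (ae_of_all _ fun w => by positivity),
    integral_transmissions hW hind hω.le hact, ← ENNReal.ofReal_mul hp.le] at h1
  have h2 := (ENNReal.ofReal_le_iff_le_toReal (ENNReal.mul_ne_top (by simp) hm')).1 h1
  rw [ENNReal.toReal_mul, ENNReal.toReal_natCast] at h2
  rw [← mul_div_assoc, div_le_iff₀ hn]
  linarith

end Random


/-! ### Mean received power -/

section PathLoss

lemma volume_closedBall_plane (x : Plane) {r : ℝ} (hr : 0 ≤ r) :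
    volume (Metric.closedBall x r) = ENNReal.ofReal (Real.pi * r ^ 2) := by
  rw [EuclideanSpace.volume_closedBall_fin_two, ← ENNReal.ofReal_pow hr,
    ← ENNReal.ofReal_mul (by positivity), mul_comm]

variable {β ν : ℝ}

/-- The factor `y` is the radial Jacobian in the plane. The integral splits at `ν`, where the path
loss stops being constant. -/
lemma integral_radial_pathLoss (hβ : 2 < β) (hν : 0 < ν) :
    IntegrableOn (fun y : ℝ => y * max y ν ^ (-β)) (Set.Ioi 0) ∧
      ∫ y in Set.Ioi (0 : ℝ), y * max y ν ^ (-β) = ν ^ (2 - β) / (2 * (1 - 2 / β)) := by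
  have e1 : Set.EqOn (fun y : ℝ => y * max y ν ^ (-β)) (fun y => y * ν ^ (-β)) (Set.Ioc 0 ν) :=
    fun y hy => by simp only [max_eq_right hy.2]
  have e2 : Set.EqOn (fun y : ℝ => y * max y ν ^ (-β)) (fun y => y ^ (1 - β)) (Set.Ioi ν) := by
    intro y hy
    have hy : ν < y := hy
    simp only [max_eq_left hy.le]
    rw [sub_eq_add_neg, Real.rpow_add (hν.trans hy), Real.rpow_one]
  have i1 : IntegrableOn (fun y : ℝ => y * max y ν ^ (-β)) (Set.Ioc 0 ν) := by
    rw [integrableOn_congr_fun e1 measurableSet_Ioc]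
    exact (Continuous.integrableOn_Icc (by fun_prop)).mono_set Set.Ioc_subset_Icc_self
  have i2 : IntegrableOn (fun y : ℝ => y * max y ν ^ (-β)) (Set.Ioi ν) := by
    rw [integrableOn_congr_fun e2 measurableSet_Ioi]
    exact integrableOn_Ioi_rpow_of_lt (by linarith) hν
  rw [← Set.Ioc_union_Ioi_eq_Ioi hν.le]
  refine ⟨i1.union i2, ?_⟩
  rw [setIntegral_union (Set.Ioc_disjoint_Ioi le_rfl) measurableSet_Ioi i1 i2,
    setIntegral_congr_fun measurableSet_Ioc e1, setIntegral_congr_fun measurableSet_Ioi e2,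
    integral_Ioi_rpow_of_lt (by linarith) hν, ← intervalIntegral.integral_of_le hν.le,
    intervalIntegral.integral_mul_const, integral_id]
  have h1 : ν ^ (2 - β) = ν ^ 2 * ν ^ (-β) := by
    rw [sub_eq_add_neg, Real.rpow_add hν]
    norm_cast
  rw [show 1 - β + 1 = 2 - β by ring, h1]
  have : β ≠ 0 := by linarith
  have : β - 2 ≠ 0 := by linarith
  have : 2 - β ≠ 0 := by linarith
  have : 1 - 2 / β ≠ 0 := by
    rw [show 1 - 2 / β = (β - 2) / β by field_simp]
    exact div_ne_zero ‹_› ‹_›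
  field_simp
  ring

lemma lintegral_pathLoss (hβ : 2 < β) (hν : 0 < ν) :
    ∫⁻ x : Plane, ENNReal.ofReal (max ‖x‖ ν ^ (-β)) =
      ENNReal.ofReal (Real.pi * ν ^ (2 - β) / (1 - 2 / β)) := by
  have hi : Integrable (fun x : Plane => max ‖x‖ ν ^ (-β)) := by
    have := (integrable_fun_norm_addHaar (volume : Measure Plane)
      (f := fun y : ℝ => max y ν ^ (-β))).2
    refine this ?_
    simpa using (integral_radial_pathLoss hβ hν).1
  rw [← ofReal_integral_eq_lintegral_ofReal hi (ae_of_all _ fun x => by positivity),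
    integral_fun_norm_addHaar (volume : Measure Plane) (fun y : ℝ => max y ν ^ (-β))]
  congr 1
  have hv : volume.real (Metric.ball (0 : Plane) 1) = Real.pi := by
    rw [Measure.real, EuclideanSpace.volume_ball_fin_two]
    simp [Real.pi_pos.le]
  rw [hv, finrank_euclideanSpace_fin]
  simp only [Nat.add_one_sub_one, pow_one, smul_eq_mul, nsmul_eq_mul]
  rw [(integral_radial_pathLoss hβ hν).2, Nat.cast_ofNat, ← div_div, mul_left_comm,
    mul_div_assoc' 2, mul_div_cancel₀ _ two_ne_zero, mul_div_assoc]

end PathLoss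

section MeanPower

/-- The event that a location has a power beacon within distance `ν`. -/
def beaconInRange (ν : ℝ) : Set (Measure Plane × Plane) :=
  {z | locallyFiniteKernel z.1 (Metric.closedBall z.2 ν) ≠ 0}

lemma measurableSet_beaconInRange (ν : ℝ) : MeasurableSet (beaconInRange ν) := by
  have hs : MeasurableSet {y : (Measure Plane × Plane) × Plane | dist y.2 y.1.2 ≤ ν} :=
    measurableSet_le (by fun_prop) measurable_const
  exact Kernel.measurable_kernel_prodMk_left (κ := fstKernel Plane) hs
    (measurableSet_singleton 0).compl

lemma mem_beaconInRange_iff {S : Set Plane} (h : LocFin S) (u : Plane) (ν : ℝ) :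
    (counting S, u) ∈ beaconInRange ν ↔ (S ∩ Metric.closedBall u ν).Nonempty := by
  change locallyFiniteKernel (counting S) (Metric.closedBall u ν) ≠ 0 ↔ _
  rw [h.kernel_apply, counting_apply h.countable measurableSet_closedBall,
    Set.nonempty_iff_ne_empty]
  simp

/-- The power that a location receives at least from its nearest beacon. -/
noncomputable def nearbyPower (β ν zm q : ℝ) : Measure Plane × Plane → ℝ≥0∞ :=
  (beaconInRange ν).indicator fun _ => ENNReal.ofReal (zm * q * ν ^ (-β))

lemma measurable_nearbyPower (β ν zm q : ℝ) : Measurable (nearbyPower β ν zm q) :=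
  measurable_const.indicator (measurableSet_beaconInRange ν)

lemma nearbyPower_le {β ν zm zs q : ℝ} {S : Set Plane} (h : LocFin S) (u : Plane) :
    nearbyPower β ν zm q (counting S, u) ≤ directedPower β ν zm zs q S u := by
  by_cases hu : (counting S, u) ∈ beaconInRange ν
  · rw [nearbyPower, Set.indicator_of_mem hu]
    rw [mem_beaconInRange_iff h] at hu
    obtain ⟨T, hT, hmin⟩ := Set.exists_min_image _ (fun x => dist x u)
      (h.inter_finite (Metric.isBounded_closedBall (x := u) (r := ν))) hu
    have hTν : dist T u ≤ ν := hT.2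
    -- The minimum over the finitely many beacons within `ν` is global, as the others are farther.
    have hnear : ∀ T' ∈ S, dist T u ≤ dist T' u := by
      intro T' hT'
      by_cases hν : dist T' u ≤ ν
      · exact hmin T' ⟨hT', hν⟩
      · exact hTν.trans (not_le.1 hν).le
    refine le_trans (le_of_eq ?_) (ENNReal.le_tsum (⟨T, hT.1⟩ : S))
    rw [if_pos hnear, max_eq_right hTν]
  · rw [nearbyPower, Set.indicator_of_notMem hu]
    exact zero_le

variable {Ω : Type*} [MeasurableSpace Ω] {Pr : Measure Ω} {dens : ℝ} {Φ : Ω → Set Plane}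
  {β ν q : ℝ}

lemma IsPoissonProcess.lintegral_isotropicOf (h : IsPoissonProcess Pr dens Φ) (hd : 0 ≤ dens)
    (hβ : 2 < β) (hν : 0 < ν) (hq : 0 ≤ q) (u : Plane) :
    ∫⁻ w, isotropicOf β ν q (counting (Φ w), u) ∂Pr =
      ENNReal.ofReal (dens * q * (Real.pi * ν ^ (2 - β) / (1 - 2 / β))) := by
  have e (w : Ω) : isotropicOf β ν q (counting (Φ w), u) =
      ∫⁻ x, ENNReal.ofReal (q * max (dist x u) ν ^ (-β)) ∂(counting (Φ w)) := by
    rw [isotropicOf, (h.locFin w).kernel_apply]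
  simp_rw [e]
  rw [h.campbell hd (by fun_prop)]
  simp_rw [ENNReal.ofReal_mul hq]
  rw [lintegral_const_mul' _ _ ENNReal.ofReal_ne_top]
  simp_rw [dist_eq_norm]
  -- Translation invariance removes the dependence on `u`.
  rw [lintegral_sub_right_eq_self (fun x : Plane => ENNReal.ofReal (max ‖x‖ ν ^ (-β))) u,
    lintegral_pathLoss hβ hν, ← mul_assoc, ← ENNReal.ofReal_mul hd,
    ← ENNReal.ofReal_mul (by positivity)]

lemma IsPoissonProcess.lintegral_nearbyPower [IsProbabilityMeasure Pr]
    (h : IsPoissonProcess Pr dens Φ) (hν : 0 < ν) (zm : ℝ) (u : Plane) :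
    ∫⁻ w, nearbyPower β ν zm q (counting (Φ w), u) ∂Pr =
      ENNReal.ofReal (zm * q * ν ^ (-β)) *
        (1 - ENNReal.ofReal (Real.exp (-(dens * (Real.pi * ν ^ 2))))) := by
  have hm : Measurable fun w => (counting (Φ w), u) := h.measurable.prodMk measurable_const
  have e : (fun w => nearbyPower β ν zm q (counting (Φ w), u)) =
      {w | (counting (Φ w), u) ∈ beaconInRange ν}.indicator
        fun _ => ENNReal.ofReal (zm * q * ν ^ (-β)) := rfl
  have hE : MeasurableSet {w | (counting (Φ w), u) ∈ beaconInRange ν} :=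
    hm (measurableSet_beaconInRange ν)
  rw [e, lintegral_indicator_const hE]
  congr 1
  have hv := h.count_law (Metric.closedBall u ν) measurableSet_closedBall
    Metric.isBounded_closedBall.measure_lt_top.ne 0
  rw [Measure.real, volume_closedBall_plane u hν.le, ENNReal.toReal_ofReal (by positivity),
    pow_zero, Nat.factorial_zero, Nat.cast_one, mul_one, div_one] at hv
  rw [← hv, ← compl_compl {w | (counting (Φ w), u) ∈ beaconInRange ν},
    prob_compl_eq_one_sub hE.compl]
  congr 2
  ext w
  change ¬ ((counting (Φ w), u) ∈ beaconInRange ν) ↔ (Φ w ∩ Metric.closedBall u ν).encard = 0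
  rw [mem_beaconInRange_iff (h.locFin w), Set.not_nonempty_iff_eq_empty, Set.encard_eq_zero]

end MeanPower

/-! ### Sustainable transmission powers in the hybrid network -/

namespace HybridNetwork

variable {lb lp duty : ℝ} (N : HybridNetwork lb lp duty)

/-- The beacons and the location of the typical mobile, which determine the received power. -/
noncomputable def scene (t : ℕ) (w : N.Ω) : Measure Plane × Plane := (counting (N.Ψ t w), N.U t 0 w)

lemma measurable_scene (t : ℕ) : Measurable (N.scene t) :=
  (N.beacons t).measurable.prodMk ((N.cellular t).measurable_mobile 0)

lemma map_scene (t : ℕ) : N.Pr.map (N.scene t) =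
    (N.Pr.map fun w => counting (N.Ψ t w)).prod (N.Pr.map (N.U t 0)) := by
  have := (N.indep_beacons t).comp (φ := fun x : (ℕ → Plane) × (ℕ → Plane) => x.2 0) (ψ := id)
    (by fun_prop) measurable_id
  exact (indepFun_iff_map_prod_eq_prod_map_map (N.beacons t).measurable.aemeasurable
    ((N.cellular t).measurable_mobile 0).aemeasurable).1 this.symm

lemma map_scene_eq (t : ℕ) : N.Pr.map (N.scene t) = N.Pr.map (N.scene 0) := by
  have hU (t : ℕ) : N.Pr.map (N.U t 0) =
      (N.Pr.map fun w => ((fun n => N.Y t n w), fun n => N.U t n w)).map fun x => x.2 0 := by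
    rw [Measure.map_map (by fun_prop)
      ((N.cellular t).measurable_stations.prodMk (N.cellular t).measurable_mobiles)]
    rfl
  rw [map_scene, map_scene, (N.beacons t).map_eq (N.beacons 0), hU t, hU 0,
    (N.cellular t).map_eq (N.cellular 0)]

/-- Beacons are independent of the typical mobile, so by Tonelli a mean that is the same at every
fixed location is also the mean at the random one. -/
lemma lintegral_scene {G : Measure Plane × Plane → ℝ≥0∞} (hG : Measurable G) (t : ℕ) {m : ℝ≥0∞}
    (h : ∀ u, ∫⁻ w, G (counting (N.Ψ t w), u) ∂N.Pr = m) : ∫⁻ w, G (N.scene t w) ∂N.Pr = m := by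
  have hU := (N.cellular t).measurable_mobile 0
  have := Measure.isProbabilityMeasure_map (μ := N.Pr) hU.aemeasurable
  have := Measure.isProbabilityMeasure_map (μ := N.Pr) (N.beacons t).measurable.aemeasurable
  rw [← lintegral_map hG (N.measurable_scene t), map_scene, lintegral_prod_symm _ hG.aemeasurable]
  have e (u : Plane) : ∫⁻ M, G (M, u) ∂(N.Pr.map fun w => counting (N.Ψ t w)) = m := by
    rw [lintegral_map (f := fun M => G (M, u)) (by fun_prop) (N.beacons t).measurable, h]
  simp [e]

/-- The activity flag and the harvested energy. -/
noncomputable def slot (G : Measure Plane × Plane → ℝ≥0∞) (t : ℕ) (w : N.Ω) : Bool × ℝ≥0∞ :=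
  (N.active t w, G (N.scene t w))

variable {G : Measure Plane × Plane → ℝ≥0∞}

lemma measurable_slot (hG : Measurable G) (t : ℕ) : Measurable (N.slot G t) :=
  (N.measurable_active t).prodMk (hG.comp (N.measurable_scene t))

lemma iIndepFun_slot (hG : Measurable G) : iIndepFun (N.slot G) N.Pr :=
  N.indep_slots.comp (fun _ x => (x.1, G (x.2.2.2, x.2.2.1 0))) fun _ => by fun_prop

lemma iIndepFun_comp_scene (hG : Measurable G) :
    iIndepFun (fun t w => G (N.scene t w)) N.Pr :=
  N.indep_slots.comp (fun _ x => G (x.2.2.2, x.2.2.1 0)) fun _ => by fun_prop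

lemma storedEnergy_eq {power : Set Plane → Plane → ℝ≥0∞}
    (h : ∀ t w, power (N.Ψ t w) (N.U t 0 w) = G (N.scene t w)) (p : ℝ) (t : ℕ) (w : N.Ω) :
    N.storedEnergy power p t w = stored p (fun t => N.slot G t w) t := by
  induction t with
  | zero => rfl
  | succ t ih =>
    rw [storedEnergy, stored, ih, h]
    rfl

lemma canTransmit_of_le {power : Set Plane → Plane → ℝ≥0∞} (hG : Measurable G)
    (h : ∀ t w, power (N.Ψ t w) (N.U t 0 w) = G (N.scene t w)) {F : Measure Plane × Plane → ℝ≥0∞}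
    (hF : Measurable F) (hFG : ∀ t w, F (N.scene t w) ≤ G (N.scene t w)) {p : ℝ} (hp : 0 < p)
    (hduty : 0 < duty) (hfin : ∫⁻ w, F (N.scene 0 w) ∂N.Pr ≠ ∞)
    (hle : ENNReal.ofReal (duty * p) ≤ ∫⁻ w, F (N.scene 0 w) ∂N.Pr) :
    N.CanTransmit power p := by
  unfold CanTransmit
  simp_rw [N.storedEnergy_eq h]
  refine tendsto_average_of_le hp (N.measurable_slot hG) (N.iIndepFun_slot hG) hduty N.active_prob
    (fun t => hF.comp (N.measurable_scene t)) (N.iIndepFun_comp_scene hF) (fun t => ?_) hFG hfin hle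
  rw [← Measure.map_map hF (N.measurable_scene t), ← Measure.map_map hF (N.measurable_scene 0),
    N.map_scene_eq]

lemma le_of_canTransmit {power : Set Plane → Plane → ℝ≥0∞} (hG : Measurable G)
    (h : ∀ t w, power (N.Ψ t w) (N.U t 0 w) = G (N.scene t w)) {p : ℝ} (hp : 0 < p)
    (hduty : 0 < duty) {m : ℝ≥0∞} (hm : ∀ t, ∫⁻ w, G (N.scene t w) ∂N.Pr = m)
    (hC : N.CanTransmit power p) : ENNReal.ofReal (duty * p) ≤ m := by
  unfold CanTransmit at hC
  simp_rw [N.storedEnergy_eq h] at hC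
  exact le_lintegral_of_tendsto_average hp (N.measurable_slot hG) (N.iIndepFun_slot hG) hduty
    N.active_prob hm hC

/-- Under isotropic radiation, a power can be sustained if and only if the mean received power
covers the mean consumption. -/
lemma canTransmit_isotropic_iff (hlp : 0 ≤ lp) (hduty : 0 < duty) {β ν q p : ℝ} (hβ : 2 < β)
    (hν : 0 < ν) (hq : 0 ≤ q) (hp : 0 < p) :
    N.CanTransmit (isotropicPower β ν q) p ↔
      duty * p ≤ lp * q * (Real.pi * ν ^ (2 - β) / (1 - 2 / β)) := by
  have hG := measurable_isotropicOf β ν q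
  have h (t : ℕ) (w : N.Ω) : isotropicPower β ν q (N.Ψ t w) (N.U t 0 w) =
      isotropicOf β ν q (N.scene t w) := isotropicPower_eq β ν q ((N.beacons t).locFin w) _
  have hm (t : ℕ) := N.lintegral_scene hG t
    fun u => (N.beacons t).lintegral_isotropicOf hlp hβ hν hq u
  have hβ' : 0 < 1 - 2 / β := by
    rw [sub_pos, div_lt_one (by linarith)]
    exact hβ
  rw [← ENNReal.ofReal_le_ofReal_iff (by positivity)]
  constructor
  · exact N.le_of_canTransmit hG h hp hduty hm
  · intro hle
    refine N.canTransmit_of_le hG h hG (fun _ _ => le_rfl) hp hduty ?_ ?_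
    · rw [hm]
      exact ENNReal.ofReal_ne_top
    · rwa [hm]

/-- Only the main lobe of a nearest beacon within `ν` is counted. Dropping the rest of the power
makes this condition merely sufficient. -/
lemma canTransmit_directed (hduty : 0 < duty) {β ν zm zs q p : ℝ}
    (hν : 0 < ν) (hz : 0 ≤ zm * q) (hp : 0 < p)
    (hle : duty * p ≤ zm * q * ν ^ (-β) * (1 - Real.exp (-(lp * (Real.pi * ν ^ 2))))) :
    N.CanTransmit (directedPower β ν zm zs q) p := by
  have hF := measurable_nearbyPower β ν zm q
  have h (t : ℕ) (w : N.Ω) : directedPower β ν zm zs q (N.Ψ t w) (N.U t 0 w) =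
      directedOf β ν zm zs q (N.scene t w) :=
    directedPower_eq β ν zm zs q ((N.beacons t).locFin w) _
  have hm := N.lintegral_scene hF 0 fun u => (N.beacons 0).lintegral_nearbyPower hν zm u
  have hm' : ∫⁻ w, nearbyPower β ν zm q (N.scene 0 w) ∂N.Pr = ENNReal.ofReal
      (zm * q * ν ^ (-β) * (1 - Real.exp (-(lp * (Real.pi * ν ^ 2))))) := by
    have hc : 0 ≤ zm * q * ν ^ (-β) := by positivity
    rw [hm, ENNReal.ofReal_mul hc, ENNReal.ofReal_sub _ (Real.exp_pos _).le,
      ENNReal.ofReal_one]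
  refine N.canTransmit_of_le (measurable_directedOf β ν zm zs q) h hF (fun t w => ?_) hp hduty ?_ ?_
  · rw [← h]
    exact nearbyPower_le ((N.beacons t).locFin w) _
  · rw [hm']
    exact ENNReal.ofReal_ne_top
  · rw [hm']
    exact ENNReal.ofReal_le_ofReal hle

end HybridNetwork


/-! ### Elimination of the transmission power -/

/-- Feasibility in terms of the transmission power. -/
lemma feasible_iff {α σ θ ε μ lb lp duty : ℝ} (hα : 2 < α) (hσ : 0 < σ) (hθ : 0 < θ) (hε : ε < 1)
    (hμ : 0 < μ) (K : ℕ) {Ω : Type*} [MeasurableSpace Ω] {Pr : Measure Ω} [IsProbabilityMeasure Pr]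
    {Y U : ℕ → Ω → Plane} (h : IsCellularNetwork Pr 1 Y U)
    (hout : Pr {w | (fun n => U n w) ∈ weakSignal α θ K μ} = ENNReal.ofReal ε)
    (N : HybridNetwork lb lp duty) (hb : 0 < lb) (power : Set Plane → Plane → ℝ≥0∞) :
    N.Feasible power α σ θ K ε ↔
      ∃ p : ℝ, 0 < p ∧ N.CanTransmit power p ∧ σ ^ 2 / μ ≤ p * lb ^ (α / 2) := by
  have key {p : ℝ} (hp : 0 ≤ p) :
      (∀ t, N.outageProb α σ θ K p t ≤ ENNReal.ofReal ε) ↔ σ ^ 2 / μ ≤ p * lb ^ (α / 2) :=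
    ⟨fun H => (h.outage_le_iff hα hσ hθ hε hμ K hout hb (N.cellular 0) hp).1 (H 0),
      fun H t => (h.outage_le_iff hα hσ hθ hε hμ K hout hb (N.cellular t) hp).2 H⟩
  constructor
  · rintro ⟨p, hp, hC, hO⟩
    rw [key hp] at hO
    refine ⟨p, hp.lt_of_ne ?_, hC, hO⟩
    rintro rfl
    rw [zero_mul] at hO
    exact absurd hO (not_le.2 (by positivity))
  · rintro ⟨p, hp, hC, hO⟩
    exact ⟨p, hp.le, hC, (key hp.le).2 hO⟩

/-- The mean power under isotropic radiation suffices for some admissible transmission power. -/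
lemma exists_power_iff {α β ν σ μ duty q lb lp : ℝ} (hβ : 2 < β) (hν : 0 < ν) (hσ : 0 < σ)
    (hμ : 0 < μ) (hduty : 0 < duty) (hb : 0 < lb) :
    (∃ p : ℝ, 0 < p ∧ duty * p ≤ lp * q * (Real.pi * ν ^ (2 - β) / (1 - 2 / β)) ∧
      σ ^ 2 / μ ≤ p * lb ^ (α / 2)) ↔
    (1 - 2 / β) * (σ ^ 2 * duty * ν ^ (β - 2) / (Real.pi * μ)) ≤ q * lp * lb ^ (α / 2) := by
  have hL : 0 < lb ^ (α / 2) := Real.rpow_pos_of_pos hb _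
  generalize lb ^ (α / 2) = L at hL
  have hc : 0 < 1 - 2 / β := by
    rw [sub_pos, div_lt_one (by linarith)]
    exact hβ
  have hV : 0 < ν ^ (β - 2) := Real.rpow_pos_of_pos hν _
  rw [show 2 - β = -(β - 2) by ring, Real.rpow_neg hν.le]
  generalize ν ^ (β - 2) = V at hV
  generalize 1 - 2 / β = c at hc
  have hk : 0 < Real.pi * V⁻¹ / c := by positivity
  have e : c * (σ ^ 2 * duty * V / (Real.pi * μ)) = duty * (σ ^ 2 / μ) / (Real.pi * V⁻¹ / c) := by
    field_simp
  rw [e, div_le_iff₀ hk]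
  generalize Real.pi * V⁻¹ / c = k at hk
  have hs : 0 < σ ^ 2 / μ := by positivity
  generalize σ ^ 2 / μ = s at hs
  constructor
  · rintro ⟨p, -, h1, h2⟩
    have h3 := mul_le_mul_of_nonneg_right h1 hL.le
    have h4 := mul_le_mul_of_nonneg_left h2 hduty.le
    linarith
  · intro h
    have h5 : s ≤ lp * q * k / duty * L := by
      rw [div_mul_eq_mul_div, le_div_iff₀ hduty]
      linarith
    -- The witness is the largest power that the mean harvest sustains.
    refine ⟨lp * q * k / duty, ?_, ?_, h5⟩
    · exact (mul_pos_iff_of_pos_right hL).1 (hs.trans_le h5)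
    · rw [mul_div_cancel₀ _ hduty.ne']

end PowerBeacon

theorem proposition4 (α β ν σ θ ε duty zm zs μ κ : ℝ) (K : ℕ)
    (hα : 2 < α) (hβ : 2 < β) (hν : 1 < ν) (hσ : 0 < σ) (hθ : 0 < θ)
    (hε₀ : 0 < ε) (hε₁ : ε < 1) (hduty₀ : 0 < duty) (hduty₁ : duty ≤ 1)
    (hzm : 0 < zm) (hzs : 0 < zs)
    -- the constant `μ`, defined through a cellular network of base-station density one
    {Ω : Type*} [MeasurableSpace Ω] (Pr : Measure Ω) [IsProbabilityMeasure Pr]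
    (Y U : ℕ → Ω → PowerBeacon.Plane) (hYU : PowerBeacon.IsCellularNetwork Pr 1 Y U)
    (hμ₀ : 0 < μ)
    (hμ : Pr {w | ENNReal.ofReal θ⁻¹ * ‖U 0 w‖ₑ ^ (-α) <
      PowerBeacon.interference α K 1 (fun n => U n w) + ENNReal.ofReal μ} = ENNReal.ofReal ε)
    (hκ : κ = duty * σ ^ 2 * ν ^ β / μ)
    -- for each pair of densities, a hybrid network with these densities
    (N : ∀ lb lp : ℝ, 0 < lb → 0 ≤ lp → PowerBeacon.HybridNetwork lb lp duty) :
    PowerBeacon.feasibilityRegion N (PowerBeacon.isotropicPower β ν) α σ θ K ε =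
        {(q, lb, lp) : ℝ × ℝ × ℝ | 0 ≤ q ∧ 0 ≤ lb ∧ 0 ≤ lp ∧
          q * lp * lb ^ (α / 2) ≥ (1 - 2 / β) * (σ ^ 2 * duty * ν ^ (β - 2) / (Real.pi * μ))} ∧
      -- where `zm * q * lb ^ (α / 2) = κ` the logarithm is infinite and no `lp` qualifies
      {(q, lb, lp) : ℝ × ℝ × ℝ | 0 ≤ q ∧ 0 ≤ lb ∧ 0 ≤ lp ∧
          zm * q * lb ^ (α / 2) ≠ κ ∧
          lp ≥ 1 / (Real.pi * ν ^ 2) *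
            Real.log (zm * q * lb ^ (α / 2) / (zm * q * lb ^ (α / 2) - κ)) ∧
          (zm * q) ^ (2 / α) * lb ≥ κ ^ (2 / α)} ⊆
        PowerBeacon.feasibilityRegion N (PowerBeacon.directedPower β ν zm zs) α σ θ K ε := by
  have hν0 : 0 < ν := by linarith
  have hc : 0 < 1 - 2 / β := by
    rw [sub_pos, div_lt_one (by linarith)]
    exact hβ
  have hrhs : 0 < (1 - 2 / β) * (σ ^ 2 * duty * ν ^ (β - 2) / (Real.pi * μ)) := by positivity
  have hα0 : α / 2 ≠ 0 := by linarith
  constructor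
  · ext ⟨q, lb, lp⟩
    constructor
    · rintro ⟨hq, hb, hp, hF⟩
      dsimp only at hq hb hp hF
      refine ⟨hq, hb.le, hp, ?_⟩
      obtain ⟨p, hp0, hC, hO⟩ :=
        (PowerBeacon.feasible_iff hα hσ hθ hε₁ hμ₀ K hYU hμ (N lb lp hb hp) hb _).1 hF
      rw [(N lb lp hb hp).canTransmit_isotropic_iff hp hduty₀ hβ hν0 hq hp0] at hC
      exact (PowerBeacon.exists_power_iff hβ hν0 hσ hμ₀ hduty₀ hb).1 ⟨p, hp0, hC, hO⟩
    · rintro ⟨hq, hb, hp, hF⟩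
      have hb : 0 < lb := by
        refine hb.lt_of_ne ?_
        rintro rfl
        rw [Real.zero_rpow hα0, mul_zero] at hF
        exact absurd hF (not_le.2 hrhs)
      obtain ⟨p, hp0, hC, hO⟩ := (PowerBeacon.exists_power_iff hβ hν0 hσ hμ₀ hduty₀ hb).2 hF
      refine ⟨hq, hb, hp, ?_⟩
      refine (PowerBeacon.feasible_iff hα hσ hθ hε₁ hμ₀ K hYU hμ (N lb lp hb hp) hb _).2
        ⟨p, hp0, ?_, hO⟩
      exact ((N lb lp hb hp).canTransmit_isotropic_iff hp hduty₀ hβ hν0 hq hp0).2 hC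
  · rintro ⟨q, lb, lp⟩ ⟨hq, hb, hp, hne, hlog, hge⟩
    have hκ0 : 0 < κ := by rw [hκ]; positivity
    have hz : 0 ≤ zm * q := by positivity
    have hb : 0 < lb := by
      refine hb.lt_of_ne ?_
      rintro rfl
      rw [mul_zero] at hge
      exact absurd hge (not_le.2 (by positivity))
    have hL : 0 < lb ^ (α / 2) := Real.rpow_pos_of_pos hb _
    have hx : κ < zm * q * lb ^ (α / 2) := by
      refine lt_of_le_of_ne ?_ hne.symm
      -- Raising to the power `α / 2` turns the last condition into `κ ≤ zm * q * lb ^ (α / 2)`;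
      -- equality is excluded by `hne`.
      have h1 := Real.rpow_le_rpow (by positivity) hge (show 0 ≤ α / 2 by linarith)
      have h2 : 2 / α * (α / 2) = 1 := by field_simp
      rwa [Real.mul_rpow (by positivity) hb.le, ← Real.rpow_mul hκ0.le, ← Real.rpow_mul hz, h2,
        Real.rpow_one, Real.rpow_one] at h1
    refine ⟨hq, hb, hp, ?_⟩
    -- The smallest power allowed by the outage constraint.
    set p : ℝ := σ ^ 2 / μ / lb ^ (α / 2) with hpdef
    have hp0 : 0 < p := by positivity
    refine (PowerBeacon.feasible_iff hα hσ hθ hε₁ hμ₀ K hYU hμ (N lb lp hb hp) hb _).2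
      ⟨p, hp0, ?_, ?_⟩
    · refine (N lb lp hb hp).canTransmit_directed hduty₀ hν0 hz hp0 ?_
      set x : ℝ := zm * q * lb ^ (α / 2) with hxdef
      have hx0 : 0 < x := hκ0.trans hx
      have hxk : 0 < x - κ := by linarith
      have h1 : Real.log (x / (x - κ)) ≤ lp * (Real.pi * ν ^ 2) := by
        rw [ge_iff_le, one_div, inv_mul_le_iff₀ (by positivity)] at hlog
        linarith
      have h2 : Real.exp (-(lp * (Real.pi * ν ^ 2))) ≤ (x - κ) / x := by
        rw [Real.exp_neg, ← inv_div]
        refine inv_anti₀ (by positivity) ?_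
        rwa [Real.log_le_iff_le_exp (by positivity)] at h1
      have h3 : κ / x ≤ 1 - Real.exp (-(lp * (Real.pi * ν ^ 2))) := by
        rw [sub_div, div_self hx0.ne'] at h2
        linarith
      -- By the choice of `κ` and `p`, `duty * p` equals `zm * q * ν ^ (-β) * (κ / x)`, so `h3` is
      -- exactly the required energy balance.
      refine le_trans (le_of_eq ?_) (mul_le_mul_of_nonneg_left h3
        (show 0 ≤ zm * q * ν ^ (-β) by positivity))
      have hzq : zm * q ≠ 0 := by
        intro h0
        rw [hxdef, h0, zero_mul] at hx0
        exact lt_irrefl _ hx0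
      have hq0 : q ≠ 0 := right_ne_zero_of_mul hzq
      have hV : 0 < ν ^ β := Real.rpow_pos_of_pos hν0 _
      rw [hpdef, hκ, hxdef, Real.rpow_neg hν0.le]
      field_simp
    · rw [hpdef, div_mul_cancel₀ _ hL.ne']
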